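/- Let $g\in C^2(\mathbb R,\mathbb R)$ and $a\in(0,1)$ satisfy $g(0)=g(a)=g(1)=0$, $g'(0)<0$, $g'(1)<0$, $g>0$ on $(-\infty,0)\cup(a,1)$ and $g<0$ on $(0,a)\cup(1,\infty)$. Let $c\neq 0$ and $\Phi\in C^1(\mathbb R,\mathbb R)$ satisfy $$-c\,\Phi'(\xi)=\Phi(\xi+1)+\Phi(\xi-1)-2\Phi(\xi)+g(\Phi(\xi))\quad(\xi\in\mathbb R),\qquad \lim_{\xi\to-\infty}\Phi(\xi)=0,\quad \lim_{\xi\to+\infty}\Phi(\xi)=1,\quad \Phi(0)=\tfrac12 .$$ Let $u^0\in\ell^\infty(\mathbb Z^2)$ satisfy $$\limsup_{i\to-\infty}\sup_{j\in\mathbb Z}u^0_{i,j}<a,\qquad \liminf_{i\to\infty}\inf_{j\in\mathbb Z}u^0_{i,j}>a,$$ and let $u\in C^1([0,\infty);\ell^\infty(\mathbb Z^2))$ be the solution of $$\dot u_{i,j}=u_{i+1,j}+u_{i,j+1}+u_{i-1,j}+u_{i,j-1}-4u_{i,j}+g(u_{i,j})\quad (t>0),\qquad u(0)=u^0 .$$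 Then there is a time $T>0$ such that for all $t\ge T$ and $j\in\mathbb Z$ there is a unique $i_*=i_*(j,t)\in\mathbb Z$ with $$0<u_{i_*,j}(t)\le\tfrac12,\qquad u_{i_*+1,j}(t)>\tfrac12 ,$$ and a unique $\xi\in\mathbb R$ with $\Phi(\xi)=u_{i_*,j}(t)$, denoted $\Phi^{-1}(u_{i_*,j}(t))$. The phases $$\gamma_j(t)=i_*(j,t)-\Phi^{-1}\big(u_{i_*(j,t),j}(t)\big)\qquad (j\in\mathbb Z,\ t\ge T)$$ are thus well defined, $\gamma(t)\in\ell^\infty(\mathbb Z)$ for every $t\ge T$, and $$\lim_{t\to\infty}\ \sup_{(i,j)\in\mathbb Z^2}\big|u_{i,j}(t)-\Phi\big(i-\gamma_j(t)\big)\big|=0 .$$ -/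

import Mathlib

open Filter Topology Set
open scoped ENNReal

namespace AllenCahn

/-- The Banach space of bounded real sequences indexed by the planar lattice, with the
supremum norm. -/
abbrev EllInf : Type := lp (fun _ : ℤ × ℤ => ℝ) ∞

/-- The discrete (plus-shaped) Laplacian on the planar lattice. -/
def discreteLaplacian (v : ℤ × ℤ → ℝ) (i j : ℤ) : ℝ :=
  v (i + 1, j) + v (i, j + 1) + v (i - 1, j) + v (i, j - 1) - 4 * v (i, j)

/-- `g` is a `C²` bistable nonlinearity with stable zeros `0`, `1` and intermediate zero `a`. -/
structure IsBistable (g : ℝ → ℝ) (a : ℝ) : Prop where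
  contDiff : ContDiff ℝ 2 g
  mem_Ioo : a ∈ Ioo (0 : ℝ) 1
  zero_eq : g 0 = 0
  mid_eq : g a = 0
  one_eq : g 1 = 0
  deriv_zero_neg : deriv g 0 < 0
  deriv_one_neg : deriv g 1 < 0
  pos : ∀ s ∈ Iio 0 ∪ Ioo a 1, 0 < g s
  neg : ∀ s ∈ Ioo 0 a ∪ Ioi 1, g s < 0

/-- `(Φ, c)` is a horizontal travelling front with non-zero speed, connecting `0` to `1` and
normalized by `Φ 0 = 1 / 2`. No monotonicity is required. -/
structure IsTravellingFront (g : ℝ → ℝ) (Φ : ℝ → ℝ) (c : ℝ) : Prop where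
  speed_ne_zero : c ≠ 0
  contDiff : ContDiff ℝ 1 Φ
  tendsto_atBot : Tendsto Φ atBot (𝓝 0)
  tendsto_atTop : Tendsto Φ atTop (𝓝 1)
  wave_eq : ∀ ξ : ℝ, -c * deriv Φ ξ = Φ (ξ + 1) + Φ (ξ - 1) - 2 * Φ ξ + g (Φ ξ)
  normalized : Φ 0 = 1 / 2

/-- The initial condition is front-like, uniformly in the vertical direction. Both the inner
suprema / infima and the outer limits are those of bounded real families. -/
structure IsFrontLike (u₀ : EllInf) (a : ℝ) : Prop where
  left : limsup (fun i : ℤ => ⨆ j : ℤ, u₀ (i, j)) atBot < a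
  right : a < liminf (fun i : ℤ => ⨅ j : ℤ, u₀ (i, j)) atTop

/-- `u ∈ C¹([0, ∞); ℓ^∞(ℤ²))` solves the discrete Allen–Cahn equation for `t > 0` and starts
at `u₀`. (Values of `u` at negative times play no role.) -/
structure IsSolution (g : ℝ → ℝ) (u₀ : EllInf) (u : ℝ → EllInf) : Prop where
  contDiffOn : ContDiffOn ℝ 1 u (Ici 0)
  hasDerivAt : ∀ t : ℝ, 0 < t → ∀ i j : ℤ,
    HasDerivAt (fun s => u s (i, j)) (discreteLaplacian (u t) i j + g (u t (i, j))) t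
  initial : u 0 = u₀

/-- The horizontal slice of `v` at height `j` crosses the value `1 / 2` upwards
between `i` and `i + 1`. -/
def IsCrossing (v : EllInf) (j i : ℤ) : Prop :=
  (0 < v (i, j) ∧ v (i, j) ≤ 1 / 2) ∧ 1 / 2 < v (i + 1, j)

/-- The crossing index `i_*` of the slice at height `j` (an arbitrary integer if there is
no crossing). -/
noncomputable def crossingIndex (v : EllInf) (j : ℤ) : ℤ :=
  Classical.epsilon fun i : ℤ => IsCrossing v j i

/-- The interpolated phase `γ_j = i_* - Φ⁻¹(v_{i_*, j})` of a lattice configuration `v`. -/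
noncomputable def phase (Φ : ℝ → ℝ) (v : EllInf) (j : ℤ) : ℝ :=
  (crossingIndex v j : ℝ) - Function.invFun Φ (v (crossingIndex v j, j))

end AllenCahn

namespace AllenCahn

/-! The proof combines squeezing between fronts with a Liouville theorem. Comparison with
Fife-McLeod supersolutions, and a reflection exchanging the states `0` and `1`, trap `u` between two
translates of the planar front `Φ (i - c t)`, up to an error vanishing as `t → ∞`
(`IsSol.exists_trap`). Recentring `u` at late times near the front, in an arbitrary row, then
produces in the limit an entire solution that tends to `0` and `1` uniformly away from the moving
front. Such an entire solution is a translate of `Φ` (`IsTravellingFront.eq_of_isEntire`). Sliding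
it against its own lattice translates shows that it depends on `i - c t` only; sliding the front
against it identifies the profile. Both rest on `exists_sliding`: the critical shift produces two
limits that touch, and the strong maximum principle makes them equal at all nonpositive times. The
same argument shows that `Φ` is increasing, which is not assumed. By contradiction and compactness,
each row of `u` is therefore close to some translate of `Φ`, uniformly over the rows
(`IsSol.exists_front_approx`). Since `Φ' > 0`, closeness to a translate forces a unique crossing of
`1 / 2` and an interpolated phase close to the translation
(`IsTravellingFront.existsUnique_crossing`). -/

/-- A locally bounded solution of the lattice equation on `[0, ∞)`, given pointwise. -/
structure IsSol (g : ℝ → ℝ) (u : ℝ → ℤ × ℤ → ℝ) : Prop where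
  continuousOn : ∀ p, ContinuousOn (fun t => u t p) (Ici 0)
  hasDerivAt : ∀ t, 0 < t → ∀ p : ℤ × ℤ,
    HasDerivAt (fun s => u s p) (discreteLaplacian (u t) p.1 p.2 + g (u t p)) t
  bdd : ∀ T, ∃ B, ∀ t ∈ Icc 0 T, ∀ p, |u t p| ≤ B

/-- An entire solution of the lattice equation with values in `[0, 1]`. -/
structure IsEntire (g : ℝ → ℝ) (w : ℝ → ℤ × ℤ → ℝ) : Prop where
  mem_Icc : ∀ t p, w t p ∈ Icc (0 : ℝ) 1
  hasDerivAt : ∀ (t : ℝ) (p : ℤ × ℤ),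
    HasDerivAt (fun s => w s p) (discreteLaplacian (w t) p.1 p.2 + g (w t p)) t

/-- `w` tends to `0` behind and to `1` ahead of the moving position `i = c t`, uniformly. -/
structure HasTails (c : ℝ) (w : ℝ → ℤ × ℤ → ℝ) : Prop where
  left : ∀ ε > 0, ∃ R : ℝ, ∀ (t : ℝ) (p : ℤ × ℤ), (p.1 : ℝ) - c * t ≤ R → w t p ≤ ε
  right : ∀ ε > 0, ∃ R : ℝ, ∀ (t : ℝ) (p : ℤ × ℤ), R ≤ (p.1 : ℝ) - c * t → 1 - ε ≤ w t p

/-! ### Comparison and strong maximum principles. -/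

lemma exists_lipschitz_bound {g : ℝ → ℝ} (hg : ContDiff ℝ 1 g) (M : ℝ) :
    ∃ L, 0 ≤ L ∧ ∀ x ∈ Icc (-M) M, ∀ y ∈ Icc (-M) M, |g x - g y| ≤ L * |x - y| := by
  obtain ⟨C, hC⟩ := (isCompact_Icc (a := -M) (b := M)).exists_bound_of_continuousOn
    (hg.continuous_deriv le_rfl).continuousOn
  refine ⟨max C 0, le_max_right _ _, fun x hx y hy => ?_⟩
  simpa using (convex_Icc (-M) M).norm_image_sub_le_of_norm_deriv_le
    (fun z _ => (hg.differentiable one_ne_zero).differentiableAt)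
    (fun z hz => (hC z hz).trans (le_max_left C 0)) hy hx

/-- After the last time at which `f ≤ H`, one has `f > H ≥ 0`, so the derivative inequality applies
and `f - H` cannot grow. Needing it only where `f > 0` suits `f = u - w`, because the supersolution
inequality is assumed only where `w < u`. -/
lemma le_of_deriv_le_of_pos {f H f' H' : ℝ → ℝ} {a b : ℝ}
    (hf : ContinuousOn f (Icc a b)) (hH : ContinuousOn H (Icc a b))
    (hf' : ∀ t ∈ Ioo a b, HasDerivAt f (f' t) t) (hH' : ∀ t ∈ Ioo a b, HasDerivAt H (H' t) t)
    (ha : f a ≤ H a) (hH0 : ∀ t ∈ Icc a b, 0 ≤ H t)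
    (h : ∀ t ∈ Ioo a b, 0 < f t → f' t ≤ H' t) : ∀ t ∈ Icc a b, f t ≤ H t := by
  intro t ht
  by_contra! hlt
  have hsub : Icc a t ⊆ Icc a b := Icc_subset_Icc_right ht.2
  set S := Icc a t ∩ (fun τ => f τ - H τ) ⁻¹' Iic 0 with hS
  have hSc : IsCompact S := by
    have : IsClosed S := ((hf.sub hH).mono hsub).preimage_isClosed_of_isClosed isClosed_Icc
      isClosed_Iic
    exact isCompact_Icc.of_isClosed_subset this inter_subset_left
  have hSn : S.Nonempty := ⟨a, ⟨le_rfl, ht.1⟩, by simpa using ha⟩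
  have hs := hSc.sSup_mem hSn
  set s := sSup S
  have hst : s ≤ t := hs.1.2
  have hpos : ∀ τ ∈ Ioo s t, H τ < f τ := by
    intro τ hτ
    by_contra! hle
    have : τ ∈ S := ⟨⟨hs.1.1.trans hτ.1.le, hτ.2.le⟩, by simpa using hle⟩
    exact absurd (le_csSup hSc.bddAbove this) (not_le.2 hτ.1)
  have hIoo : ∀ τ ∈ Ioo s t, τ ∈ Ioo a b := fun τ hτ =>
    ⟨hs.1.1.trans_lt hτ.1, hτ.2.trans_le ht.2⟩
  have hanti : AntitoneOn (fun τ => f τ - H τ) (Icc s t) := by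
    refine antitoneOn_of_deriv_nonpos (convex_Icc s t)
      ((hf.sub hH).mono (Icc_subset_Icc hs.1.1 ht.2)) ?_ ?_
    · rw [interior_Icc]
      exact fun τ hτ => ((hf' τ (hIoo τ hτ)).sub
        (hH' τ (hIoo τ hτ))).differentiableAt.differentiableWithinAt
    · rw [interior_Icc]
      intro τ hτ
      have h1 := hIoo τ hτ
      have h2 : deriv (fun τ => f τ - H τ) τ = f' τ - H' τ := ((hf' τ h1).sub (hH' τ h1)).deriv
      rw [h2]
      linarith [h τ h1 ((hH0 τ ⟨h1.1.le, h1.2.le⟩).trans_lt (hpos τ hτ))]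
  have h3 := hanti ⟨le_rfl, hst⟩ ⟨hst, le_rfl⟩ hst
  have h4 : f s - H s ≤ 0 := hs.2
  simp only at h3
  linarith

/-- The comparison principle: a solution stays below every supersolution that is bounded below
and lies above it initially. -/
theorem IsSol.le_of_supersolution {g : ℝ → ℝ} (hg : ContDiff ℝ 1 g) {u w w' : ℝ → ℤ × ℤ → ℝ}
    {t₀ t₁ : ℝ} (hu : IsSol g u) (ht₀ : 0 ≤ t₀)
    (hwc : ∀ p, ContinuousOn (fun t => w t p) (Icc t₀ t₁))
    (hwd : ∀ t ∈ Ioo t₀ t₁, ∀ p, HasDerivAt (fun s => w s p) (w' t p) t)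
    (hsup : ∀ t ∈ Ioo t₀ t₁, ∀ p : ℤ × ℤ, w t p < u t p →
      discreteLaplacian (w t) p.1 p.2 + g (w t p) ≤ w' t p)
    (hlow : ∃ B, ∀ t ∈ Icc t₀ t₁, ∀ p, -B ≤ w t p)
    (h0 : ∀ p, u t₀ p ≤ w t₀ p) : ∀ t ∈ Icc t₀ t₁, ∀ p, u t p ≤ w t p := by
  obtain ⟨B₁, hB₁⟩ := hlow
  obtain ⟨B₂, hB₂⟩ := hu.bdd t₁
  set B := max (max B₁ B₂) 0
  have hB0 : 0 ≤ B := le_max_right _ _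
  have hwB : ∀ t ∈ Icc t₀ t₁, ∀ p, -B ≤ w t p := fun t ht p =>
    (neg_le_neg ((le_max_left _ _).trans (le_max_left _ _))).trans (hB₁ t ht p)
  have huB : ∀ t ∈ Icc t₀ t₁, ∀ p, |u t p| ≤ B := fun t ht p =>
    (hB₂ t ⟨ht₀.trans ht.1, ht.2⟩ p).trans ((le_max_right _ _).trans (le_max_left _ _))
  obtain ⟨L, hL0, hL⟩ := exists_lipschitz_bound hg B
  -- Picard iteration replaces Gronwall for the supremum over the lattice, which need not be
  -- differentiable in time. The rate `4 + L` counts four neighbours and the Lipschitz constant; the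
  -- diagonal term `-4 (u - w)` has a favourable sign where `w < u`.
  have key : ∀ n : ℕ, ∀ t ∈ Icc t₀ t₁, ∀ p,
      u t p - w t p ≤ 2 * B * (((4 + L) * (t - t₀)) ^ n / n.factorial) := by
    intro n
    induction n with
    | zero =>
      intro t ht p
      have := abs_le.1 (huB t ht p)
      simp
      linarith [hwB t ht p]
    | succ n ih =>
      intro t ht p
      refine le_of_deriv_le_of_pos
        (f := fun t => u t p - w t p)
        (H := fun t => 2 * B * (((4 + L) * (t - t₀)) ^ (n + 1) / (n + 1).factorial))
        (f' := fun t => discreteLaplacian (u t) p.1 p.2 + g (u t p) - w' t p)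
        (H' := fun t => (4 + L) * (2 * B * (((4 + L) * (t - t₀)) ^ n / n.factorial)))
        (((hu.continuousOn p).mono fun s hs => ht₀.trans hs.1).sub (hwc p))
        (by fun_prop) ?_ ?_ ?_ ?_ ?_ t ht
      · exact fun s hs => (hu.hasDerivAt s (ht₀.trans_lt hs.1) p).sub (hwd s hs p)
      · intro s _
        have h1 : HasDerivAt (fun t => (4 + L) * (t - t₀)) (4 + L) s := by
          simpa using ((hasDerivAt_id s).sub_const t₀).const_mul (4 + L)
        have h2 := (((h1.pow (n + 1)).div_const ((n + 1).factorial : ℝ)).const_mul (2 * B))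
        refine h2.congr_deriv ?_
        have : (n.factorial : ℝ) ≠ 0 := by positivity
        rw [Nat.factorial_succ]
        push_cast
        field_simp
      · simp [h0 p]
      · intro s hs
        have : 0 ≤ s - t₀ := sub_nonneg.2 hs.1
        positivity
      · intro s hs hpos
        have hs' : s ∈ Icc t₀ t₁ := ⟨hs.1.le, hs.2.le⟩
        have hlt : w s p < u s p := by simpa using hpos
        have h1 := hsup s hs p hlt
        have h2 := abs_le.1 (huB s hs' p)
        -- No upper bound on `w` is needed: where the estimate is used, `w < u ≤ B`.
        have h3 := hL (u s p) h2 (w s p) ⟨hwB s hs' p, hlt.le.trans h2.2⟩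
        have h4 := (le_abs_self _).trans h3
        rw [abs_of_pos (sub_pos.2 hlt)] at h4
        have e0 := ih s hs' p
        have e1 := ih s hs' (p.1 + 1, p.2)
        have e2 := ih s hs' (p.1, p.2 + 1)
        have e3 := ih s hs' (p.1 - 1, p.2)
        have e4 := ih s hs' (p.1, p.2 - 1)
        have e5 := mul_le_mul_of_nonneg_left e0 hL0
        simp only [discreteLaplacian, Prod.mk.eta] at h1 ⊢
        linarith
  intro t ht p
  have hlim : Tendsto (fun n : ℕ => 2 * B * (((4 + L) * (t - t₀)) ^ n / n.factorial)) atTop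
      (𝓝 (2 * B * 0)) := (FloorSemiring.tendsto_pow_div_factorial_atTop _).const_mul _
  have := ge_of_tendsto' hlim fun n => key n t ht p
  simp at this
  linarith

lemma forall_of_neighbours {P : ℤ × ℤ → Prop} {p₀ : ℤ × ℤ} (h0 : P p₀)
    (h : ∀ p : ℤ × ℤ, P p → P (p.1 + 1, p.2) ∧ P (p.1, p.2 + 1) ∧ P (p.1 - 1, p.2) ∧
      P (p.1, p.2 - 1)) (p : ℤ × ℤ) : P p := by
  have h1 : ∀ n : ℤ, P (p₀.1 + n, p₀.2) := by
    intro n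
    induction n using Int.induction_on with
    | zero => simpa using h0
    | succ i ih => simpa [add_assoc] using (h _ ih).1
    | pred i ih => simpa [add_sub_assoc] using (h _ ih).2.2.1
  have h2 : ∀ m n : ℤ, P (p₀.1 + n, p₀.2 + m) := by
    intro m n
    induction m using Int.induction_on with
    | zero => simpa using h1 n
    | succ i ih => simpa [add_assoc] using (h _ ih).2.1
    | pred i ih => simpa [add_sub_assoc] using (h _ ih).2.2.2
  simpa using h2 (p.2 - p₀.2) (p.1 - p₀.1)

/-- The strong maximum principle for nonnegative entire supersolutions of a linear lattice
equation. -/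
theorem eq_zero_of_supersolution {z z' : ℝ → ℤ × ℤ → ℝ} {L : ℝ} (hz : ∀ t p, 0 ≤ z t p)
    (hd : ∀ t p, HasDerivAt (fun s => z s p) (z' t p) t)
    (hz' : ∀ (t : ℝ) (p : ℤ × ℤ), discreteLaplacian (z t) p.1 p.2 - L * z t p ≤ z' t p)
    {t₀ : ℝ} {p₀ : ℤ × ℤ} (h0 : z t₀ p₀ = 0) : ∀ t ≤ t₀, ∀ p, z t p = 0 := by
  have hnbr : ∀ p, z t₀ p = 0 := by
    intro p
    refine forall_of_neighbours (P := fun p => z t₀ p = 0) h0 (fun p hp => ?_) p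
    -- A zero is a minimum in time, so `z' = 0` there; the inequality then forces the four
    -- nonnegative neighbours to vanish.
    have hmin : IsLocalMin (fun s => z s p) t₀ := by
      refine Eventually.of_forall fun s => ?_
      simpa [hp] using hz s p
    have h1 := hz' t₀ p
    rw [hmin.hasDerivAt_eq_zero (hd t₀ p)] at h1
    simp only [discreteLaplacian, Prod.mk.eta, hp] at h1
    have e1 := hz t₀ (p.1 + 1, p.2)
    have e2 := hz t₀ (p.1, p.2 + 1)
    have e3 := hz t₀ (p.1 - 1, p.2)
    have e4 := hz t₀ (p.1, p.2 - 1)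
    refine ⟨?_, ?_, ?_, ?_⟩ <;> linarith
  intro t ht p
  -- The integrating factor carries vanishing at `t₀` backwards in time.
  have hmono : Monotone (fun s => Real.exp ((4 + L) * s) * z s p) := by
    have hder : ∀ s, HasDerivAt (fun s => Real.exp ((4 + L) * s) * z s p)
        (Real.exp ((4 + L) * s) * (4 + L) * z s p + Real.exp ((4 + L) * s) * z' s p) s := by
      intro s
      have h1 : HasDerivAt (fun s => (4 + L) * s) (4 + L) s := by
        simpa using (hasDerivAt_id s).const_mul (4 + L)
      exact h1.exp.mul (hd s p)
    refine monotone_of_deriv_nonneg (fun s => (hder s).differentiableAt) fun s => ?_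
    rw [(hder s).deriv]
    have h1 := hz' s p
    simp only [discreteLaplacian, Prod.mk.eta] at h1
    have e1 := hz s (p.1 + 1, p.2)
    have e2 := hz s (p.1, p.2 + 1)
    have e3 := hz s (p.1 - 1, p.2)
    have e4 := hz s (p.1, p.2 - 1)
    have : 0 ≤ (4 + L) * z s p + z' s p := by linarith
    nlinarith [Real.exp_pos ((4 + L) * s)]
  have h1 := hmono ht
  simp only [hnbr p, mul_zero] at h1
  have h2 := hz t p
  have h3 : z t p ≤ 0 := by
    by_contra! h
    exact absurd h1 (not_le.2 (mul_pos (Real.exp_pos _) h))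
  linarith

/-! ### Compactness: ultralimits of solutions. -/

lemma abs_laplacian_sub_le {v w : ℤ × ℤ → ℝ} {C : ℝ} (h : ∀ p, |v p - w p| ≤ C) (p : ℤ × ℤ) :
    |discreteLaplacian v p.1 p.2 - discreteLaplacian w p.1 p.2| ≤ 8 * C := by
  have e0 := abs_le.1 (h p)
  have e1 := abs_le.1 (h (p.1 + 1, p.2))
  have e2 := abs_le.1 (h (p.1, p.2 + 1))
  have e3 := abs_le.1 (h (p.1 - 1, p.2))
  have e4 := abs_le.1 (h (p.1, p.2 - 1))
  simp only [discreteLaplacian, Prod.mk.eta]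
  rw [abs_le]
  constructor <;> linarith

lemma tendsto_laplacian {ι : Type*} {l : Filter ι} {V : ι → ℤ × ℤ → ℝ} {v : ℤ × ℤ → ℝ}
    (h : ∀ p, Tendsto (fun k => V k p) l (𝓝 (v p))) (i j : ℤ) :
    Tendsto (fun k => discreteLaplacian (V k) i j) l (𝓝 (discreteLaplacian v i j)) :=
  ((((h _).add (h _)).add (h _)).add (h _)).sub ((h _).const_mul 4)

lemma exists_time_lipschitz_bound {g : ℝ → ℝ} (hg : ContDiff ℝ 1 g) (M : ℝ) :
    ∃ C, 0 ≤ C ∧ ∀ (w : ℝ → ℤ × ℤ → ℝ) (τ : ℝ), (∀ t p, τ < t → |w t p| ≤ M) →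
      (∀ (t : ℝ) (p : ℤ × ℤ), τ < t →
        HasDerivAt (fun s => w s p) (discreteLaplacian (w t) p.1 p.2 + g (w t p)) t) →
      ∀ s t p, τ < s → τ < t → |w s p - w t p| ≤ C * |s - t| := by
  obtain ⟨G, hG⟩ := (isCompact_Icc (a := -M) (b := M)).exists_bound_of_continuousOn
    hg.continuous.continuousOn
  refine ⟨max (8 * M + G) 0, le_max_right _ _, fun w τ hM hd s t p hs ht => ?_⟩
  have := (convex_Ioi τ).norm_image_sub_le_of_norm_hasDerivWithin_le (C := max (8 * M + G) 0)
    (f := fun s => w s p) (f' := fun t => discreteLaplacian (w t) p.1 p.2 + g (w t p))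
    (fun r hr => (hd r p hr).hasDerivWithinAt) (fun r hr => ?_) (mem_Ioi.2 ht) (mem_Ioi.2 hs)
  · simpa using this
  · have h1 := abs_laplacian_sub_le (v := w r) (w := fun _ => 0) (C := M)
      (fun q => by simpa using hM r q hr) p
    have h2 := hG (w r p) (abs_le.1 (hM r p hr))
    have h3 : discreteLaplacian (fun _ => 0) p.1 p.2 = 0 := by simp [discreteLaplacian]
    rw [h3, sub_zero] at h1
    exact (norm_add_le _ _).trans ((add_le_add h1 h2).trans (le_max_left _ _))

/-- The remainder constant depends only on `g` and `M`, so the estimate survives pointwise limits.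
It thereby yields the differential equation for the limit without any convergence of derivatives.
The start time `τ` allows for translates that solve the equation only after time `-k`. -/
lemma exists_taylor_bound {g : ℝ → ℝ} (hg : ContDiff ℝ 1 g) (M : ℝ) :
    ∃ C, 0 ≤ C ∧ ∀ (w : ℝ → ℤ × ℤ → ℝ) (τ : ℝ), (∀ t p, τ < t → |w t p| ≤ M) →
      (∀ (t : ℝ) (p : ℤ × ℤ), τ < t →
        HasDerivAt (fun s => w s p) (discreteLaplacian (w t) p.1 p.2 + g (w t p)) t) →
      ∀ (s t : ℝ) (p : ℤ × ℤ), τ < s → τ < t →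
        |w s p - w t p - (s - t) * (discreteLaplacian (w t) p.1 p.2 + g (w t p))| ≤
          C * |s - t| ^ 2 := by
  obtain ⟨C₁, hC₁, h₁⟩ := exists_time_lipschitz_bound hg M
  obtain ⟨L, hL₀, hL⟩ := exists_lipschitz_bound hg M
  refine ⟨8 * C₁ + L * C₁, by positivity, fun w τ hM hd s t p hs ht => ?_⟩
  have hseg : ∀ r ∈ uIcc t s, τ < r := fun r hr => (lt_min ht hs).trans_le hr.1
  have := (convex_uIcc t s).norm_image_sub_le_of_norm_hasDerivWithin_le
    (C := (8 * C₁ + L * C₁) * |s - t|)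
    (f := fun r => w r p - (r - t) * (discreteLaplacian (w t) p.1 p.2 + g (w t p)))
    (f' := fun r => discreteLaplacian (w r) p.1 p.2 + g (w r p) -
      1 * (discreteLaplacian (w t) p.1 p.2 + g (w t p)))
    (fun r hr => ((hd r p (hseg r hr)).sub
      (((hasDerivAt_id r).sub_const t).mul_const _)).hasDerivWithinAt) (fun r hr => ?_)
    left_mem_uIcc right_mem_uIcc
  · simp only [sub_self, zero_mul, sub_zero, Real.norm_eq_abs] at this
    refine le_trans (le_of_eq ?_) (this.trans (le_of_eq ?_))
    · congr 1; ring
    · ring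
  · have hrt : |r - t| ≤ |s - t| := by
      have := abs_sub_left_of_mem_uIcc hr
      simpa using this
    have e : ∀ q, |w r q - w t q| ≤ C₁ * |s - t| := fun q =>
      (h₁ w τ hM hd r t q (hseg r hr) ht).trans (by gcongr)
    have e1 := abs_laplacian_sub_le e p
    have e2 := hL _ (abs_le.1 (hM r p (hseg r hr))) _ (abs_le.1 (hM t p ht))
    have e3 := e2.trans (mul_le_mul_of_nonneg_left (e p) hL₀)
    rw [Real.norm_eq_abs]
    calc _ = |(discreteLaplacian (w r) p.1 p.2 - discreteLaplacian (w t) p.1 p.2) +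
          (g (w r p) - g (w t p))| := by congr 1; ring
      _ ≤ _ := abs_add_le _ _
      _ ≤ _ := add_le_add e1 e3
      _ = _ := by ring

lemma exists_tendsto_hyperfilter {f : ℕ → ℝ} {M : ℝ}
    (h : ∀ᶠ k in hyperfilter ℕ, |f k| ≤ M) :
    ∃ x, |x| ≤ M ∧ Tendsto f (hyperfilter ℕ) (𝓝 x) := by
  obtain ⟨x, hx, hx'⟩ := (isCompact_Icc (a := -M) (b := M)).ultrafilter_le_nhds
    ((hyperfilter ℕ).map f) (by
      rw [le_principal_iff]
      exact h.mono fun k hk => abs_le.1 hk)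
  exact ⟨x, abs_le.2 hx, hx'⟩

lemma eventually_neg_lt_hyperfilter (t : ℝ) : ∀ᶠ k : ℕ in hyperfilter ℕ, -(k : ℝ) < t := by
  have h : ∀ᶠ k : ℕ in atTop, -(k : ℝ) < t := by
    filter_upwards [eventually_gt_atTop ⌈-t⌉₊] with k hk
    have := (Nat.le_ceil (-t)).trans_lt (Nat.cast_lt.2 hk)
    linarith
  exact Nat.hyperfilter_le_atTop h

/-- Ultralimits of uniformly bounded solutions are entire solutions. -/
theorem exists_ultralimit {g : ℝ → ℝ} (hg : ContDiff ℝ 1 g) (W : ℕ → ℝ → ℤ × ℤ → ℝ) (M : ℝ)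
    (hM : ∀ (k : ℕ) t p, -(k : ℝ) < t → |W k t p| ≤ M)
    (hd : ∀ (k : ℕ) (t : ℝ) (p : ℤ × ℤ), -(k : ℝ) < t →
      HasDerivAt (fun s => W k s p) (discreteLaplacian (W k t) p.1 p.2 + g (W k t p)) t) :
    ∃ w : ℝ → ℤ × ℤ → ℝ, (∀ t p, Tendsto (fun k => W k t p) (hyperfilter ℕ) (𝓝 (w t p))) ∧
      ∀ (t : ℝ) (p : ℤ × ℤ),
        HasDerivAt (fun s => w s p) (discreteLaplacian (w t) p.1 p.2 + g (w t p)) t := by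
  -- A fixed ultrafilter gives limits at all the uncountably many `(t, p)` at once, without
  -- extracting subsequences.
  have hex : ∀ t p, ∃ x, |x| ≤ M ∧ Tendsto (fun k => W k t p) (hyperfilter ℕ) (𝓝 x) :=
    fun t p => exists_tendsto_hyperfilter
      ((eventually_neg_lt_hyperfilter t).mono fun k hk => hM k t p hk)
  choose w _ hw using hex
  refine ⟨w, hw, fun t p => ?_⟩
  obtain ⟨C, hC, hT⟩ := exists_taylor_bound hg M
  have hbound : ∀ s, |w s p - w t p - (s - t) * (discreteLaplacian (w t) p.1 p.2 + g (w t p))| ≤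
      C * |s - t| ^ 2 := by
    intro s
    have hlim := ((((hw s p).sub (hw t p)).sub (((tendsto_laplacian (hw t) p.1 p.2).add
      ((hg.continuous.tendsto _).comp (hw t p))).const_mul (s - t))).abs)
    refine le_of_tendsto hlim ?_
    filter_upwards [eventually_neg_lt_hyperfilter s, eventually_neg_lt_hyperfilter t]
      with k hs ht
    exact hT (W k) (-k) (hM k) (hd k) s t p hs ht
  rw [hasDerivAt_iff_isLittleO]
  have hO : (fun s => w s p - w t p - (s - t) • (discreteLaplacian (w t) p.1 p.2 + g (w t p)))
      =O[𝓝 t] fun s => |s - t| ^ 2 := by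
    refine Asymptotics.IsBigO.of_bound C (Eventually.of_forall fun s => ?_)
    simpa using hbound s
  refine hO.trans_isLittleO ?_
  have h1 : (fun s : ℝ => (s - t) * (s - t)) =o[𝓝 t] fun s => 1 * (s - t) := by
    refine Asymptotics.IsLittleO.mul_isBigO ?_ (Asymptotics.isBigO_refl _ _)
    rw [Asymptotics.isLittleO_one_iff]
    exact (by fun_prop : Continuous fun s : ℝ => s - t).tendsto' t 0 (by simp)
  simpa [sq] using h1

lemma laplacian_shift (v : ℤ × ℤ → ℝ) (q : ℤ × ℤ) (i j : ℤ) :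
    discreteLaplacian (fun p => v (p + q)) i j = discreteLaplacian v (i + q.1) (j + q.2) := by
  obtain ⟨k, l⟩ := q
  simp only [discreteLaplacian, Prod.mk_add_mk]
  rw [add_right_comm i, add_right_comm j, sub_add_eq_add_sub i, sub_add_eq_add_sub j]

lemma IsEntire.shift {g : ℝ → ℝ} {w : ℝ → ℤ × ℤ → ℝ} (hw : IsEntire g w) (σ : ℝ) (q : ℤ × ℤ) :
    IsEntire g fun t p => w (t + σ) (p + q) where
  mem_Icc t p := hw.mem_Icc _ _
  hasDerivAt t p := by
    rw [laplacian_shift]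
    exact (hw.hasDerivAt (t + σ) (p + q)).comp_add_const t σ

lemma IsEntire.abs_le_one {g : ℝ → ℝ} {w : ℝ → ℤ × ℤ → ℝ} (hw : IsEntire g w) (t : ℝ)
    (p : ℤ × ℤ) : |w t p| ≤ 1 :=
  abs_le.2 ⟨by linarith [(hw.mem_Icc t p).1], (hw.mem_Icc t p).2⟩

lemma IsEntire.continuous {g : ℝ → ℝ} {w : ℝ → ℤ × ℤ → ℝ} (hw : IsEntire g w) (p : ℤ × ℤ) :
    Continuous fun t => w t p :=
  continuous_iff_continuousAt.2 fun t => (hw.hasDerivAt t p).continuousAt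

lemma HasTails.shift {c : ℝ} {w : ℝ → ℤ × ℤ → ℝ} (hw : HasTails c w) (σ : ℝ) (q : ℤ × ℤ) :
    HasTails c fun t p => w (t + σ) (p + q) where
  left ε hε := by
    obtain ⟨R, hR⟩ := hw.left ε hε
    refine ⟨R - q.1 + c * σ, fun t p h => hR _ _ ?_⟩
    push_cast [Prod.fst_add]
    linarith
  right ε hε := by
    obtain ⟨R, hR⟩ := hw.right ε hε
    refine ⟨R - q.1 + c * σ, fun t p h => hR _ _ ?_⟩
    push_cast [Prod.fst_add]
    linarith

/-- Recentring within bounded distance of the front moves the tail thresholds by at most `C`. -/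
lemma HasTails.ultralimit {c C : ℝ} {w v : ℝ → ℤ × ℤ → ℝ} {τ : ℕ → ℝ} {q : ℕ → ℤ × ℤ}
    (hw : HasTails c w) (hC : ∀ k, |((q k).1 : ℝ) - c * τ k| ≤ C)
    (hv : ∀ t p, Tendsto (fun k => w (t + τ k) (p + q k)) (hyperfilter ℕ) (𝓝 (v t p))) :
    HasTails c v where
  left ε hε := by
    obtain ⟨R, hR⟩ := hw.left ε hε
    refine ⟨R - C, fun t p h => le_of_tendsto' (hv t p) fun k => hR _ _ ?_⟩
    have := abs_le.1 (hC k)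
    push_cast [Prod.fst_add]
    linarith
  right ε hε := by
    obtain ⟨R, hR⟩ := hw.right ε hε
    refine ⟨R + C, fun t p h => ge_of_tendsto' (hv t p) fun k => hR _ _ ?_⟩
    have := abs_le.1 (hC k)
    push_cast [Prod.fst_add]
    linarith

lemma exists_entire_ultralimit {g : ℝ → ℝ} (hg : ContDiff ℝ 1 g) {W : ℕ → ℝ → ℤ × ℤ → ℝ}
    (hW : ∀ k, IsEntire g (W k)) :
    ∃ w, IsEntire g w ∧ ∀ t p, Tendsto (fun k => W k t p) (hyperfilter ℕ) (𝓝 (w t p)) := by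
  obtain ⟨w, hw, hd⟩ := exists_ultralimit hg W 1 (fun k t p _ => (hW k).abs_le_one t p)
    (fun k t p _ => (hW k).hasDerivAt t p)
  exact ⟨w, ⟨fun t p => isClosed_Icc.mem_of_tendsto (hw t p)
    (Eventually.of_forall fun k => (hW k).mem_Icc t p), hd⟩, hw⟩

/-! ### Sliding and monotonicity of entire solutions. -/

/-- Two entire solutions are ordered as soon as they can only be in the wrong order where the
nonlinearity is decreasing. -/
theorem IsEntire.le_of_strictAntiOn {g : ℝ → ℝ} (hg : ContDiff ℝ 1 g) {w v : ℝ → ℤ × ℤ → ℝ}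
    (hw : IsEntire g w) (hv : IsEntire g v) {η : ℝ} (hη₀ : StrictAntiOn g (Icc 0 η))
    (hη₁ : StrictAntiOn g (Icc (1 - η) 1))
    (h : ∀ t p, w t p < v t p → v t p ≤ η ∨ 1 - η ≤ w t p) (t : ℝ) (p : ℤ × ℤ) :
    v t p ≤ w t p := by
  by_contra! hlt
  set D : ℝ × (ℤ × ℤ) → ℝ := fun x => w x.1 x.2 - v x.1 x.2
  have hDb : BddBelow (range D) := by
    refine ⟨-1, ?_⟩
    rintro _ ⟨x, rfl⟩
    have h1 := (hw.mem_Icc x.1 x.2).1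
    have h2 := (hv.mem_Icc x.1 x.2).2
    simp only [D]
    linarith
  set m := sInf (range D)
  have hm : ∀ x, m ≤ D x := fun x => csInf_le hDb ⟨x, rfl⟩
  have hm0 : m < 0 := (hm (t, p)).trans_lt (by simpa [D] using hlt)
  -- The negative infimum of `w - v` need not be attained. Recentring at near-minimizers gives
  -- limits that attain it at the origin, where the time derivative vanishes, the Laplacian of the
  -- difference is nonnegative and `g w' - g v' > 0`: a contradiction.
  have hx : ∀ k : ℕ, ∃ x, D x < m + 1 / ((k : ℝ) + 1) := by
    intro k
    have : sInf (range D) < m + 1 / ((k : ℝ) + 1) := lt_add_of_pos_right _ (by positivity)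
    obtain ⟨_, ⟨x, rfl⟩, hx⟩ := exists_lt_of_csInf_lt (range_nonempty D) this
    exact ⟨x, hx⟩
  choose x hx using hx
  obtain ⟨w', hw', hwt⟩ := exists_entire_ultralimit hg fun k => hw.shift (x k).1 (x k).2
  obtain ⟨v', hv', hvt⟩ := exists_entire_ultralimit hg fun k => hv.shift (x k).1 (x k).2
  have hge : ∀ t p, m ≤ w' t p - v' t p := fun t p =>
    ge_of_tendsto' ((hwt t p).sub (hvt t p)) fun k => hm (t + (x k).1, p + (x k).2)
  have h00 := (hwt 0 0).sub (hvt 0 0)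
  simp only [zero_add] at h00
  have heq : w' 0 0 - v' 0 0 = m := by
    refine tendsto_nhds_unique h00 ?_
    have hlim : Tendsto (fun k : ℕ => m + 1 / ((k : ℝ) + 1)) atTop (𝓝 (m + 0)) :=
      tendsto_one_div_add_atTop_nhds_zero_nat.const_add m
    rw [add_zero] at hlim
    exact (tendsto_of_tendsto_of_tendsto_of_le_of_le tendsto_const_nhds hlim
      (fun k => hm (x k)) (fun k => (hx k).le)).mono_left Nat.hyperfilter_le_atTop
  have hcase : v' 0 0 ≤ η ∨ 1 - η ≤ w' 0 0 := by
    have hev : ∀ᶠ k in hyperfilter ℕ, v (x k).1 (x k).2 ≤ η ∨ 1 - η ≤ w (x k).1 (x k).2 := by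
      filter_upwards [h00.eventually_lt_const (heq.trans_lt hm0)] with k hk
      exact h _ _ (by linarith)
    have hw0 := hwt 0 0
    have hv0 := hvt 0 0
    simp only [zero_add] at hw0 hv0
    rcases Ultrafilter.eventually_or.1 hev with h1 | h1
    · exact Or.inl (le_of_tendsto hv0 h1)
    · exact Or.inr (ge_of_tendsto hw0 h1)
  have hlt' : w' 0 0 < v' 0 0 := by linarith
  have hgg : g (v' 0 0) < g (w' 0 0) := by
    have a1 := hw'.mem_Icc 0 0
    have a2 := hv'.mem_Icc 0 0
    rcases hcase with h1 | h1
    · exact hη₀ ⟨a1.1, hlt'.le.trans h1⟩ ⟨a2.1, h1⟩ hlt'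
    · exact hη₁ ⟨h1, a1.2⟩ ⟨h1.trans hlt'.le, a2.2⟩ hlt'
  have hmin : IsLocalMin (fun s => w' s 0 - v' s 0) 0 :=
    Eventually.of_forall fun s => heq.le.trans (hge s 0)
  have hder := hmin.hasDerivAt_eq_zero ((hw'.hasDerivAt 0 0).sub (hv'.hasDerivAt 0 0))
  simp only [discreteLaplacian, Prod.mk.eta] at hder
  have e1 := hge 0 ((0 : ℤ × ℤ).1 + 1, (0 : ℤ × ℤ).2)
  have e2 := hge 0 ((0 : ℤ × ℤ).1, (0 : ℤ × ℤ).2 + 1)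
  have e3 := hge 0 ((0 : ℤ × ℤ).1 - 1, (0 : ℤ × ℤ).2)
  have e4 := hge 0 ((0 : ℤ × ℤ).1, (0 : ℤ × ℤ).2 - 1)
  linarith

/-- Sliding: the least time shift (in units of distance) that puts `w` above `v`, together with a
pair of ultralimits of translates for which this shift turns the inequality into an equality. -/
theorem exists_sliding {g : ℝ → ℝ} (hg : ContDiff ℝ 1 g) {w v : ℝ → ℤ × ℤ → ℝ} {c η : ℝ}
    (hc : c ≠ 0) (hη : 0 < η) (hη₀ : StrictAntiOn g (Icc 0 η))
    (hη₁ : StrictAntiOn g (Icc (1 - η) 1)) (hw : IsEntire g w) (hv : IsEntire g v)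
    (tw : HasTails c w) (tv : HasTails c v) :
    ∃ s₀, (∀ s, s₀ ≤ s → ∀ t p, v t p ≤ w (t - s / c) p) ∧
      ∃ (τ : ℕ → ℝ) (q : ℕ → ℤ × ℤ) (C : ℝ) (w' v' : ℝ → ℤ × ℤ → ℝ),
        (∀ k, |((q k).1 : ℝ) - c * τ k| ≤ C) ∧
        (∀ t p, Tendsto (fun k => w (t + τ k) (p + q k)) (hyperfilter ℕ) (𝓝 (w' t p))) ∧
        (∀ t p, Tendsto (fun k => v (t + τ k) (p + q k)) (hyperfilter ℕ) (𝓝 (v' t p))) ∧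
        ∀ t ≤ 0, ∀ p, v' t p = w' (t - s₀ / c) p := by
  have hξ : ∀ (t s : ℝ) (p : ℤ × ℤ),
      (p.1 : ℝ) - c * (t - s / c) = p.1 - c * t + s := by
    intro t s p; field_simp; ring
  obtain ⟨R₁, hR₁⟩ := tw.right η hη
  obtain ⟨R₂, hR₂⟩ := tv.left η hη
  obtain ⟨R₃, hR₃⟩ := tw.left (1 / 4) (by norm_num)
  obtain ⟨R₄, hR₄⟩ := tv.right (1 / 4) (by norm_num)
  have hA : ∀ s, (∀ t p, w (t - s / c) p < v t p → v t p ≤ η ∨ 1 - η ≤ w (t - s / c) p) →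
      ∀ t p, v t p ≤ w (t - s / c) p := by
    intro s hs
    have := (hw.shift (-(s / c)) 0).le_of_strictAntiOn hg hv hη₀ hη₁
    simp only [add_zero, ← sub_eq_add_neg] at this
    exact this hs
  -- All larger shifts are included in the condition because monotonicity in the shift is not yet
  -- known.
  set A : Set ℝ := {s | ∀ s', s ≤ s' → ∀ t p, v t p ≤ w (t - s' / c) p} with hAdef
  have hAne : A.Nonempty := by
    refine ⟨R₁ - R₂, fun s hs => hA s fun t p _ => ?_⟩
    rcases le_total ((p.1 : ℝ) - c * t) R₂ with h | h
    · exact Or.inl (hR₂ t p h)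
    · exact Or.inr (hR₁ _ _ (by rw [hξ]; linarith))
  have hAb : BddBelow A := by
    refine ⟨R₃ - ⌈R₄⌉, fun s hs => ?_⟩
    by_contra! hlt
    have h1 := hs s le_rfl 0 (⌈R₄⌉, 0)
    have h2 := hR₄ 0 (⌈R₄⌉, 0) (by simpa using Int.le_ceil R₄)
    have h3 := hR₃ (0 - s / c) (⌈R₄⌉, 0) (by rw [hξ]; simp only [mul_zero, sub_zero]; linarith)
    linarith
  set s₀ := sInf A
  have hgt : ∀ s, s₀ < s → ∀ t p, v t p ≤ w (t - s / c) p := by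
    intro s hs
    obtain ⟨r, hr, hrs⟩ := exists_lt_of_csInf_lt hAne hs
    exact hr s hrs.le
  have hs₀ : ∀ s, s₀ ≤ s → ∀ t p, v t p ≤ w (t - s / c) p := by
    intro s hs t p
    rcases hs.eq_or_lt with rfl | hs
    · have hcont : Continuous fun s => w (t - s / c) p := (hw.continuous p).comp (by fun_prop)
      refine ge_of_tendsto (hcont.continuousAt.continuousWithinAt (s := Ioi s₀)) ?_
      filter_upwards [self_mem_nhdsWithin] with s hs using hgt s hs t p
    · exact hgt s hs t p
  refine ⟨s₀, hs₀, ?_⟩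
  -- Just below `s₀` the ordering fails, and by `hA` it fails at a point where `v > η` and `w < 1 -
  -- η`. The tails confine such points to bounded distance from the front.
  have hseq : ∀ k : ℕ, ∃ s t p, s₀ - 1 / ((k : ℝ) + 1) ≤ s ∧ s < s₀ ∧ w (t - s / c) p < v t p ∧
      η < v t p ∧ w (t - s / c) p < 1 - η := by
    intro k
    have hk : s₀ - 1 / ((k : ℝ) + 1) ∉ A := fun hmem => by
      have h1 := csInf_le hAb hmem
      have : (0 : ℝ) < 1 / ((k : ℝ) + 1) := by positivity
      linarith
    simp only [hAdef, mem_ofPred_eq, not_forall] at hk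
    obtain ⟨s, hs, hk⟩ := hk
    have hlt : s < s₀ := by
      by_contra! hle
      obtain ⟨t, p, h⟩ := hk
      exact h (hs₀ s hle t p)
    have hn : ¬ ∀ t p, w (t - s / c) p < v t p → v t p ≤ η ∨ 1 - η ≤ w (t - s / c) p := fun h => by
      obtain ⟨t, p, h'⟩ := hk
      exact h' (hA s h t p)
    push Not at hn
    obtain ⟨t, p, h1, h2, h3⟩ := hn
    exact ⟨s, t, p, hs, hlt, h1, h2, h3⟩
  choose s τ q hs hs' hlt hvη hwη using hseq
  obtain ⟨w', hw', hwt⟩ := exists_entire_ultralimit hg fun k => hw.shift (τ k) (q k)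
  obtain ⟨v', hv', hvt⟩ := exists_entire_ultralimit hg fun k => hv.shift (τ k) (q k)
  refine ⟨τ, q, |R₂| + |R₁ - s₀ + 1|, w', v', fun k => ?_, hwt, hvt, ?_⟩
  · have h1 : R₂ < (q k).1 - c * τ k := by
      by_contra! h
      linarith [hR₂ _ _ h, hvη k]
    have h2 : (q k).1 - c * τ k + s k < R₁ := by
      by_contra! h
      rw [← hξ] at h
      linarith [hR₁ _ _ h, hwη k]
    have h3 : 1 / ((k : ℝ) + 1) ≤ 1 := by
      rw [div_le_one (by positivity)]
      linarith [Nat.cast_nonneg (α := ℝ) k]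
    rw [abs_le]
    constructor
    · linarith [neg_abs_le R₂, abs_nonneg (R₁ - s₀ + 1), hs k]
    · linarith [le_abs_self (R₁ - s₀ + 1), abs_nonneg R₂, hs k]
  obtain ⟨K, hK, hKb⟩ := exists_time_lipschitz_bound hg 1
  obtain ⟨L, hL, hLb⟩ := exists_lipschitz_bound hg 1
  have hle : ∀ t p, v' t p ≤ w' (t - s₀ / c) p := by
    intro t p
    refine le_of_tendsto_of_tendsto' (hvt t p) (hwt (t - s₀ / c) p) fun k => ?_
    have := hs₀ s₀ le_rfl (t + τ k) (p + q k)
    rwa [add_sub_right_comm] at this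
  -- The failing shifts `s k` tend to `s₀` and `w` is Lipschitz in time, so the limits touch at the
  -- origin.
  have hw0 : w' (0 - s₀ / c) 0 ≤ v' 0 0 := by
    have hlim : Tendsto (fun k : ℕ => K * ((1 / ((k : ℝ) + 1)) * |c⁻¹|)) (hyperfilter ℕ)
        (𝓝 (K * (0 * |c⁻¹|))) :=
      ((tendsto_one_div_add_atTop_nhds_zero_nat.mono_left Nat.hyperfilter_le_atTop).mul_const
        _).const_mul K
    have h2 := (hvt 0 0).add hlim
    rw [zero_mul, mul_zero, add_zero] at h2
    refine le_of_tendsto_of_tendsto' (hwt (0 - s₀ / c) 0) h2 fun k => ?_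
    simp only [zero_add, zero_sub]
    set r := min (-(s₀ / c) + τ k) (τ k - s k / c) - 1
    have h3 := hKb w r (fun t p _ => hw.abs_le_one t p) (fun t p _ => hw.hasDerivAt t p)
      (-(s₀ / c) + τ k) (τ k - s k / c) (q k)
      (by linarith [min_le_left (-(s₀ / c) + τ k) (τ k - s k / c)])
      (by linarith [min_le_right (-(s₀ / c) + τ k) (τ k - s k / c)])
    have h4 : -(s₀ / c) + τ k - (τ k - s k / c) = (s k - s₀) * c⁻¹ := by
      field_simp; ring
    rw [h4, abs_mul] at h3
    have h5 : |s k - s₀| ≤ 1 / ((k : ℝ) + 1) := by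
      rw [abs_le]; constructor <;> linarith [hs k, hs' k]
    have h6 : K * (|s k - s₀| * |c⁻¹|) ≤ K * (1 / ((k : ℝ) + 1) * |c⁻¹|) := by gcongr
    linarith [le_abs_self (w (-(s₀ / c) + τ k) (q k) - w (τ k - s k / c) (q k)), hlt k]
  have hzero := eq_zero_of_supersolution (L := L)
    (z := fun t p => w' (t - s₀ / c) p - v' t p) (t₀ := 0) (p₀ := 0)
    (fun t p => sub_nonneg.2 (hle t p))
    (fun t p => ((hw'.hasDerivAt (t - s₀ / c) p).comp_sub_const t (s₀ / c)).sub
      (hv'.hasDerivAt t p)) (fun t p => ?_) (by linarith [hle 0 0])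
  · exact fun t ht p => (sub_eq_zero.1 (hzero t ht p)).symm
  · have h1 := hLb _ (abs_le.1 (hw'.abs_le_one (t - s₀ / c) p)) _ (abs_le.1 (hv'.abs_le_one t p))
    rw [abs_of_nonneg (sub_nonneg.2 (hle t p))] at h1
    have h2 := (abs_le.1 h1).1
    simp only [discreteLaplacian, Prod.mk.eta]
    linarith

/-- Entire solutions with uniform tails are monotone in every direction that moves ahead of the
front. -/
theorem HasTails.le_shift_of_nonneg {g : ℝ → ℝ} (hg : ContDiff ℝ 1 g) {v : ℝ → ℤ × ℤ → ℝ}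
    {c η : ℝ} (hc : c ≠ 0) (hη : 0 < η) (hη₀ : StrictAntiOn g (Icc 0 η))
    (hη₁ : StrictAntiOn g (Icc (1 - η) 1)) (hv : IsEntire g v) (tv : HasTails c v) (q : ℤ × ℤ)
    {s : ℝ} (hs : 0 ≤ s) (t : ℝ) (p : ℤ × ℤ) : v t p ≤ v (t + (q.1 - s) / c) (p + q) := by
  -- The translate used here preserves `i - c t`. If its critical shift `s₀` were positive, a limit
  -- of `v` would be invariant, for `t ≤ 0`, under a translation that advances `i - c t` by `s₀`.
  -- Iterating would join a value at most `1 / 4` to one at least `3 / 4`.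
  obtain ⟨s₀, hs₀, τ, r, C, w', v', hC, hwt, hvt, heq⟩ := exists_sliding hg hc hη hη₀ hη₁
    (hv.shift (q.1 / c) q) hv (tv.shift (q.1 / c) q) tv
  rcases le_or_gt s₀ 0 with h0 | h0
  · have := hs₀ s (h0.trans hs) t p
    rwa [sub_add, ← sub_div, ← neg_sub (q.1 : ℝ) s, neg_div, sub_neg_eq_add] at this
  exfalso
  have tv' := tv.ultralimit hC hvt
  have hw' : ∀ t p, w' t p = v' (t + q.1 / c) (p + q) := by
    intro t p
    refine tendsto_nhds_unique (hwt t p) ?_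
    simpa only [add_right_comm] using hvt (t + q.1 / c) (p + q)
  set σ := (q.1 - s₀) / c with hσ
  have hcσ : c * σ = q.1 - s₀ := by rw [hσ]; field_simp
  have hper : ∀ t ≤ 0, ∀ p, v' t p = v' (t + σ) (p + q) := by
    intro t ht p
    rw [heq t ht p, hw', hσ]
    congr 1
    ring
  obtain ⟨R₁, hR₁⟩ := tv'.left (1 / 4) (by norm_num)
  obtain ⟨R₂, hR₂⟩ := tv'.right (1 / 4) (by norm_num)
  obtain ⟨n, hn⟩ := exists_nat_ge ((R₂ - ⌊R₁⌋) / s₀)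
  rw [div_le_iff₀ h0] at hn
  obtain ⟨m, hm⟩ := exists_nat_ge ((⌈R₂⌉ - R₁) / s₀)
  rw [div_le_iff₀ h0] at hm
  -- The invariance is known only for `t ≤ 0`; the sign of `σ` decides in which direction the
  -- iteration stays there.
  rcases le_or_gt σ 0 with hσ0 | hσ0
  · have hit : ∀ (n : ℕ) p, v' (n * σ) (p + n • q) = v' 0 p := by
      intro n p
      induction n with
      | zero => simp
      | succ n ih =>
        rw [← ih, hper _ (mul_nonpos_of_nonneg_of_nonpos n.cast_nonneg hσ0)]
        push_cast
        rw [add_mul, one_mul, succ_nsmul, add_assoc]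
    have h1 := hR₁ 0 (⌊R₁⌋, 0) (by simpa using Int.floor_le R₁)
    have h2 := hR₂ (n * σ) ((⌊R₁⌋, 0) + n • q) (by
      rw [← mul_assoc, mul_comm c, mul_assoc, hcσ]
      simp only [Prod.fst_add, Prod.smul_fst]
      push_cast [nsmul_eq_mul]
      linarith)
    rw [hit] at h2
    linarith
  · have hit : ∀ (n : ℕ) p, v' (-(n * σ)) (p - n • q) = v' 0 p := by
      intro n p
      induction n with
      | zero => simp
      | succ n ih =>
        rw [← ih, hper (-(((n + 1 : ℕ) : ℝ) * σ)) (neg_nonpos.2 (by positivity))]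
        congr 1
        · push_cast; ring
        · rw [succ_nsmul]; abel
    have h1 := hR₂ 0 (⌈R₂⌉, 0) (by simpa using Int.le_ceil R₂)
    have h2 := hR₁ (-(m * σ)) ((⌈R₂⌉, 0) - m • q) (by
      rw [mul_neg, ← mul_assoc, mul_comm c, mul_assoc, hcσ]
      simp only [Prod.fst_sub, Prod.smul_fst]
      push_cast [nsmul_eq_mul]
      linarith)
    rw [hit] at h2
    linarith

/-! ### Properties and uniqueness of the travelling front. -/

lemma exists_strictAntiOn_of_deriv_neg {g : ℝ → ℝ} (hg : ContDiff ℝ 1 g) {r : ℝ}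
    (hr : deriv g r < 0) : ∃ δ > 0, StrictAntiOn g (Icc (r - δ) (r + δ)) := by
  have h := (hg.continuous_deriv le_rfl).continuousAt.eventually_lt_const hr
  obtain ⟨δ, hδ, h⟩ := Metric.eventually_nhds_iff_ball.1 h
  refine ⟨δ, hδ, strictAntiOn_of_deriv_neg (convex_Icc _ _) hg.continuous.continuousOn ?_⟩
  intro x hx
  rw [interior_Icc, ← Real.ball_eq_Ioo] at hx
  exact h x hx

lemma IsBistable.contDiff_one {g : ℝ → ℝ} {a : ℝ} (hg : IsBistable g a) : ContDiff ℝ 1 g :=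
  hg.contDiff.of_le (by norm_num)

lemma IsBistable.exists_strictAntiOn {g : ℝ → ℝ} {a : ℝ} (hg : IsBistable g a) :
    ∃ η > 0, StrictAntiOn g (Icc 0 η) ∧ StrictAntiOn g (Icc (1 - η) 1) := by
  obtain ⟨δ₀, hδ₀, h₀⟩ := exists_strictAntiOn_of_deriv_neg hg.contDiff_one hg.deriv_zero_neg
  obtain ⟨δ₁, hδ₁, h₁⟩ := exists_strictAntiOn_of_deriv_neg hg.contDiff_one hg.deriv_one_neg
  refine ⟨min δ₀ δ₁, lt_min hδ₀ hδ₁, h₀.mono (Icc_subset_Icc (by linarith) ?_),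
    h₁.mono (Icc_subset_Icc ?_ (by linarith))⟩
  · linarith [min_le_left δ₀ δ₁]
  · linarith [min_le_right δ₀ δ₁]

namespace IsTravellingFront

variable {g Φ : ℝ → ℝ} {a c : ℝ}

/-- A value outside the interval would give a global extremum, where `Φ' = 0` while the second
difference and `g` have the same sign, with `g` nonzero. -/
lemma mem_Icc (hg : IsBistable g a) (hΦ : IsTravellingFront g Φ c) (x : ℝ) :
    Φ x ∈ Icc (0 : ℝ) 1 := by
  constructor
  · by_contra! hx
    obtain ⟨y, hy⟩ := hΦ.contDiff.continuous.exists_forall_le' x (by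
      rw [cocompact_eq_atBot_atTop, eventually_sup]
      exact ⟨(hΦ.tendsto_atBot.eventually_const_lt hx).mono fun _ h => h.le,
        (hΦ.tendsto_atTop.eventually_const_lt (hx.trans one_pos)).mono fun _ h => h.le⟩)
    have h1 : IsLocalMin Φ y := Eventually.of_forall hy
    have h2 := hΦ.wave_eq y
    rw [h1.deriv_eq_zero] at h2
    have h3 := hg.pos (Φ y) (Or.inl ((hy x).trans_lt hx))
    linarith [hy (y + 1), hy (y - 1)]
  · by_contra! hx
    obtain ⟨y, hy⟩ := hΦ.contDiff.continuous.exists_forall_ge' x (by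
      rw [cocompact_eq_atBot_atTop, eventually_sup]
      exact ⟨(hΦ.tendsto_atBot.eventually_lt_const (one_pos.trans hx)).mono fun _ h => h.le,
        (hΦ.tendsto_atTop.eventually_lt_const hx).mono fun _ h => h.le⟩)
    have h1 : IsLocalMax Φ y := Eventually.of_forall hy
    have h2 := hΦ.wave_eq y
    rw [h1.deriv_eq_zero] at h2
    have h3 := hg.neg (Φ y) (Or.inr (hx.trans_le (hy x)))
    linarith [hy (y + 1), hy (y - 1)]

lemma hasDerivAt (hΦ : IsTravellingFront g Φ c) (x : ℝ) : HasDerivAt Φ (deriv Φ x) x :=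
  ((hΦ.contDiff.differentiable one_ne_zero) x).hasDerivAt

lemma isEntire (hg : IsBistable g a) (hΦ : IsTravellingFront g Φ c) :
    IsEntire g fun t p => Φ (p.1 - c * t) where
  mem_Icc t p := hΦ.mem_Icc hg _
  hasDerivAt t p := by
    have h1 : HasDerivAt (fun s => (p.1 : ℝ) - c * s) (-c) t := by
      simpa using ((hasDerivAt_id t).const_mul c).const_sub (p.1 : ℝ)
    refine ((hΦ.hasDerivAt _).comp t h1).congr_deriv ?_
    have := hΦ.wave_eq (p.1 - c * t)
    simp only [discreteLaplacian, Int.cast_add, Int.cast_sub, Int.cast_one]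
    rw [add_sub_right_comm (p.1 : ℝ) 1, sub_right_comm (p.1 : ℝ) 1]
    linarith

lemma hasTails (hΦ : IsTravellingFront g Φ c) : HasTails c fun t p => Φ (p.1 - c * t) where
  left ε hε := by
    obtain ⟨R, hR⟩ := eventually_atBot.1 (hΦ.tendsto_atBot.eventually_lt_const hε)
    exact ⟨R, fun t p h => (hR _ h).le⟩
  right ε hε := by
    obtain ⟨R, hR⟩ := eventually_atTop.1
      (hΦ.tendsto_atTop.eventually_const_lt (by linarith : 1 - ε < 1))
    exact ⟨R, fun t p h => (hR _ h).le⟩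

lemma monotone (hg : IsBistable g a) (hΦ : IsTravellingFront g Φ c) : Monotone Φ := by
  obtain ⟨η, hη, hη₀, hη₁⟩ := hg.exists_strictAntiOn
  have hc := hΦ.speed_ne_zero
  intro x y hxy
  have := hΦ.hasTails.le_shift_of_nonneg hg.contDiff_one hc hη hη₀ hη₁ (hΦ.isEntire hg) 0
    (sub_nonneg.2 hxy) (-x / c) 0
  have e1 : (0 : ℝ) - c * (-x / c) = x := by field_simp; ring
  have e2 : (0 : ℝ) - c * (-x / c + (0 - (y - x)) / c) = y := by field_simp; ring
  simpa only [add_zero, Prod.fst_zero, Int.cast_zero, e1, e2] using this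

lemma hasDerivAt_deriv (hg : IsBistable g a) (hΦ : IsTravellingFront g Φ c) (x : ℝ) :
    HasDerivAt (deriv Φ) (-(1 / c) * (deriv Φ (x + 1) + deriv Φ (x - 1) - 2 * deriv Φ x +
      deriv g (Φ x) * deriv Φ x)) x := by
  have hc := hΦ.speed_ne_zero
  have h1 : deriv Φ = fun x => -(1 / c) * (Φ (x + 1) + Φ (x - 1) - 2 * Φ x + g (Φ x)) := by
    funext y
    rw [← hΦ.wave_eq y]
    field_simp
  rw [h1]
  refine HasDerivAt.const_mul _ ?_
  rw [← h1]
  exact ((((hΦ.hasDerivAt (x + 1)).comp_add_const x 1).add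
    ((hΦ.hasDerivAt (x - 1)).comp_sub_const x 1)).sub ((hΦ.hasDerivAt x).const_mul 2)).add
    (((hg.contDiff_one.differentiable one_ne_zero) (Φ x)).hasDerivAt.comp x (hΦ.hasDerivAt x))

/-- `Φ'` is a nonnegative solution of the linearised lattice equation, so the strong maximum
principle turns one zero into `Φ' = 0` everywhere, against the two distinct limits. -/
lemma deriv_pos (hg : IsBistable g a) (hΦ : IsTravellingFront g Φ c) (x : ℝ) :
    0 < deriv Φ x := by
  have hc := hΦ.speed_ne_zero
  have h0 : ∀ x, 0 ≤ deriv Φ x := fun x => (hΦ.monotone hg).deriv_nonneg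
  refine (h0 x).lt_of_ne' fun hx => ?_
  obtain ⟨L, hL⟩ := (isCompact_Icc (a := (0 : ℝ)) (b := 1)).exists_bound_of_continuousOn
    (hg.contDiff_one.continuous_deriv le_rfl).continuousOn
  have hzero := eq_zero_of_supersolution (L := L)
    (z := fun t p => deriv Φ (p.1 - c * t)) (t₀ := -x / c) (p₀ := 0)
    (z' := fun t p => -(1 / c) * (deriv Φ (p.1 - c * t + 1) + deriv Φ (p.1 - c * t - 1) -
      2 * deriv Φ (p.1 - c * t) + deriv g (Φ (p.1 - c * t)) * deriv Φ (p.1 - c * t)) * -c)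
    (fun t p => h0 _) (fun t p => ?_) (fun t p => ?_) ?_
  · have hall : ∀ y, deriv Φ y = 0 := by
      intro y
      rcases hc.lt_or_gt with hneg | hpos
      · have h2 := hzero (-(y - ⌈y - x⌉) / c) (by
          rw [div_le_div_right_of_neg hneg]
          linarith [Int.le_ceil (y - x)]) (⌈y - x⌉, 0)
        rw [← h2]
        congr 1
        simp only
        field_simp
        ring
      · have h2 := hzero (-(y - ⌊y - x⌋) / c) (by
          rw [div_le_div_iff_of_pos_right hpos]
          linarith [Int.floor_le (y - x)]) (⌊y - x⌋, 0)
        rw [← h2]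
        congr 1
        simp only
        field_simp
        ring
    have hconst := is_const_of_deriv_eq_zero (hΦ.contDiff.differentiable one_ne_zero) hall
    have h1 : Tendsto Φ atTop (𝓝 (Φ 0)) := by
      rw [show Φ = fun _ => Φ 0 from funext fun y => hconst y 0]
      exact tendsto_const_nhds
    have h2 := tendsto_nhds_unique h1 hΦ.tendsto_atTop
    rw [hΦ.normalized] at h2
    norm_num at h2
  · have h1 : HasDerivAt (fun s => (p.1 : ℝ) - c * s) (-c) t := by
      simpa using ((hasDerivAt_id t).const_mul c).const_sub (p.1 : ℝ)
    exact (hΦ.hasDerivAt_deriv hg _).comp t h1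
  · have h1 := (abs_le.1 (hL _ (hΦ.mem_Icc hg (p.1 - c * t)))).1
    have h2 := mul_le_mul_of_nonneg_right h1 (h0 (p.1 - c * t))
    simp only [discreteLaplacian, Int.cast_add, Int.cast_sub, Int.cast_one]
    rw [add_sub_right_comm (p.1 : ℝ) 1, sub_right_comm (p.1 : ℝ) 1]
    have h3 : ∀ A : ℝ, -(1 / c) * A * -c = A := fun A => by field_simp
    rw [h3]
    linarith
  · simp only [Prod.fst_zero, Int.cast_zero]
    rw [show (0 : ℝ) - c * (-x / c) = x by field_simp; ring, hx]

lemma strictMono (hg : IsBistable g a) (hΦ : IsTravellingFront g Φ c) : StrictMono Φ :=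
  strictMono_of_deriv_pos (hΦ.deriv_pos hg)

/-- Up to translation, the front is the only entire solution with uniform tails. -/
theorem eq_of_isEntire (hg : IsBistable g a) (hΦ : IsTravellingFront g Φ c)
    {v : ℝ → ℤ × ℤ → ℝ} (hv : IsEntire g v) (tv : HasTails c v) :
    ∃ θ, ∀ (t : ℝ) (p : ℤ × ℤ), v t p = Φ (p.1 - c * t + θ) := by
  obtain ⟨η, hη, hη₀, hη₁⟩ := hg.exists_strictAntiOn
  have hc := hΦ.speed_ne_zero
  -- Monotonicity under `q` and under `-q`, with zero shift, gives invariance, so `v` depends only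
  -- on `i - c t`.
  have hshift : ∀ t p (q : ℤ × ℤ), v t p = v (t + q.1 / c) (p + q) := by
    intro t p q
    have h := fun q => tv.le_shift_of_nonneg hg.contDiff_one hc hη hη₀ hη₁ hv q le_rfl
    refine le_antisymm (by simpa using h q t p) ?_
    have := h (-q) (t + q.1 / c) (p + q)
    simpa [neg_div] using this
  set Ψ : ℝ → ℝ := fun ξ => v (-ξ / c) 0
  have hΨc : Continuous Ψ := (hv.continuous 0).comp (by fun_prop)
  have hΨ : ∀ (t : ℝ) (p : ℤ × ℤ), v t p = Ψ (p.1 - c * t) := by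
    intro t p
    have := hshift t p (-p)
    rw [add_neg_cancel] at this
    rw [this]
    simp only [Ψ, Prod.fst_neg, Int.cast_neg]
    congr 1
    field_simp
    ring
  obtain ⟨s₀, -, τ, q, C, w', v', hC, hwt, hvt, heq⟩ := exists_sliding hg.contDiff_one hc hη hη₀
    hη₁ (hΦ.isEntire hg) hv hΦ.hasTails tv
  -- The recentring points have bounded front coordinate, so both sliding limits are translates of
  -- the original profiles by the same `ξ`.
  obtain ⟨ξ, -, hξ⟩ := exists_tendsto_hyperfilter (f := fun k => ((q k).1 : ℝ) - c * τ k)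
    (Eventually.of_forall hC)
  have hlim : ∀ (F : ℝ → ℝ), Continuous F → ∀ (t : ℝ) (p : ℤ × ℤ),
      Tendsto (fun k => F (((p + q k).1 : ℤ) - c * (t + τ k))) (hyperfilter ℕ)
        (𝓝 (F (p.1 - c * t + ξ))) := by
    intro F hF t p
    refine (hF.tendsto _).comp ((hξ.const_add ((p.1 : ℝ) - c * t)).congr fun k => ?_)
    push_cast [Prod.fst_add]
    ring
  have hw' : ∀ (t : ℝ) (p : ℤ × ℤ), w' t p = Φ (p.1 - c * t + ξ) := fun t p =>
    tendsto_nhds_unique (hwt t p) (hlim Φ hΦ.contDiff.continuous t p)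
  have hv' : ∀ (t : ℝ) (p : ℤ × ℤ), v' t p = Ψ (p.1 - c * t + ξ) := fun t p =>
    tendsto_nhds_unique (hvt t p) (by simpa only [hΨ] using hlim Ψ hΨc t p)
  refine ⟨s₀, fun t p => ?_⟩
  rw [hΨ]
  have key : ∀ x, Ψ x = Φ (x + s₀) := by
    intro x
    have : ∃ t ≤ 0, ∃ i : ℤ, (i : ℝ) - c * t + ξ = x := by
      rcases hc.lt_or_gt with hneg | hpos
      · refine ⟨(⌈x - ξ⌉ - (x - ξ)) / c, div_nonpos_of_nonneg_of_nonpos ?_ hneg.le, ⌈x - ξ⌉, ?_⟩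
        · linarith [Int.le_ceil (x - ξ)]
        · field_simp; ring
      · refine ⟨(⌊x - ξ⌋ - (x - ξ)) / c, div_nonpos_of_nonpos_of_nonneg ?_ hpos.le, ⌊x - ξ⌋, ?_⟩
        · linarith [Int.floor_le (x - ξ)]
        · field_simp; ring
    obtain ⟨t, ht, i, rfl⟩ := this
    have h1 := heq t ht (i, 0)
    rw [hw', hv'] at h1
    simp only at h1
    rw [h1]
    congr 1
    field_simp
    ring
  exact key _

end IsTravellingFront

/-! ### Trapping between two fronts. -/

lemma IsSol.exists_le_one_add {g : ℝ → ℝ} {a : ℝ} (hg : IsBistable g a) {u : ℝ → ℤ × ℤ → ℝ}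
    (hu : IsSol g u) {ε : ℝ} (hε : 0 < ε) : ∃ T, 0 ≤ T ∧ ∀ p, u T p ≤ 1 + ε := by
  obtain ⟨B, hB⟩ := hu.bdd 0
  set M := max B (1 + ε)
  have hM : 1 + ε ≤ M := le_max_right _ _
  obtain ⟨x, hx, hmax⟩ := (isCompact_Icc (a := 1 + ε) (b := M)).exists_isMaxOn
    (nonempty_Icc.2 hM) hg.contDiff.continuous.continuousOn
  have hδ : 0 < -g x := neg_pos.2 (hg.neg x (Or.inr (mem_Ioi.2 (by linarith [hx.1]))))
  -- The barrier `M - δ t` falls at the slowest decay rate of `g` on `[1 + ε, M]` and reaches `1 +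
  -- ε` at time `T`.
  set δ := -g x with hδdef
  refine ⟨(M - (1 + ε)) / δ, div_nonneg (sub_nonneg.2 hM) hδ.le, ?_⟩
  set T := (M - (1 + ε)) / δ with hT
  have hδT : δ * T = M - (1 + ε) := by rw [hT]; field_simp
  have hT0 : 0 ≤ T := div_nonneg (sub_nonneg.2 hM) hδ.le
  have := hu.le_of_supersolution hg.contDiff_one (t₀ := 0) (t₁ := T)
    (w := fun t _ => M - δ * t) (w' := fun _ _ => -δ) le_rfl (fun p => by fun_prop)
    (fun t _ p => by simpa using ((hasDerivAt_id t).const_mul δ).const_sub M)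
    (fun t ht p _ => ?_) ⟨M, fun t ht p => ?_⟩ (fun p => ?_) T ⟨hT0, le_rfl⟩
  · intro p
    linarith [this p]
  · have h1 : δ * t ≤ δ * T := mul_le_mul_of_nonneg_left ht.2.le hδ.le
    have h2 : 0 ≤ δ * t := mul_nonneg hδ.le ht.1.le
    have h3 : g (M - δ * t) ≤ g x := hmax ⟨by linarith, by linarith⟩
    simp only [discreteLaplacian]
    linarith
  · have h1 : δ * t ≤ δ * T := mul_le_mul_of_nonneg_left ht.2 hδ.le
    linarith
  · have h1 := (abs_le.1 (hB 0 ⟨le_rfl, le_rfl⟩ p)).2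
    rw [mul_zero, sub_zero]
    exact h1.trans (le_max_left B (1 + ε))

lemma IsSol.exists_le_left {g : ℝ → ℝ} {a : ℝ} (hg : IsBistable g a) {u : ℝ → ℤ × ℤ → ℝ}
    (hu : IsSol g u) {ρ z : ℝ} (hρ : 0 < ρ) (hρa : ρ < a) (hz : ρ < z) {I : ℤ}
    (hI : ∀ i ≤ I, ∀ j, u 0 (i, j) ≤ ρ) {T : ℝ} (hT : 0 ≤ T) :
    ∃ I' : ℤ, ∀ i ≤ I', ∀ j, u T (i, j) ≤ z := by
  obtain ⟨B₀, hB₀⟩ := hu.bdd T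
  set B := max B₀ 1
  have hB1 : 1 ≤ B := le_max_right _ _
  have hB : ∀ t ∈ Icc 0 T, ∀ p, |u t p| ≤ B := fun t ht p =>
    (hB₀ t ht p).trans (le_max_left _ _)
  have ha1 := hg.mem_Ioo.2
  obtain ⟨L, hL0, hL⟩ := exists_lipschitz_bound hg.contDiff_one B
  -- The rate absorbs the two horizontal neighbours of the exponential and the Lipschitz error,
  -- while `g ρ < 0`. The supersolution inequality is only needed where the barrier lies below `u ≤
  -- B`, hence in the Lipschitz range.
  set lam := Real.exp 1 + Real.exp (-1) + L
  have hlam : 0 ≤ lam := by positivity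
  have key := hu.le_of_supersolution hg.contDiff_one (t₀ := 0) (t₁ := T)
    (w := fun t p => ρ + B * Real.exp (p.1 - I + lam * t))
    (w' := fun t p => B * (Real.exp (p.1 - I + lam * t) * lam)) le_rfl (fun p => by fun_prop)
    (fun t _ p => ?_) (fun t ht p hlt => ?_) ⟨0, fun t _ p => ?_⟩ (fun p => ?_) T ⟨hT, le_rfl⟩
  · refine ⟨⌊Real.log ((z - ρ) / B) + I - lam * T⌋, fun i hi j => (key (i, j)).trans ?_⟩
    have h1 : (i : ℝ) ≤ Real.log ((z - ρ) / B) + I - lam * T := Int.le_floor.1 hi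
    have hpos : 0 < (z - ρ) / B := div_pos (sub_pos.2 hz) (by linarith)
    have h2 : Real.exp (i - I + lam * T) ≤ (z - ρ) / B := by
      rw [← Real.le_log_iff_exp_le hpos]
      linarith
    rw [le_div_iff₀ (by linarith)] at h2
    simp only
    linarith
  · have h1 : HasDerivAt (fun s => (p.1 : ℝ) - I + lam * s) lam t := by
      simpa using ((hasDerivAt_id t).const_mul lam).const_add ((p.1 : ℝ) - I)
    exact (h1.exp.const_mul B).const_add ρ
  · have e1 : Real.exp ((p.1 : ℝ) + 1 - I + lam * t) =
        Real.exp 1 * Real.exp (p.1 - I + lam * t) := by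
      rw [← Real.exp_add]; congr 1; ring
    have e2 : Real.exp ((p.1 : ℝ) - 1 - I + lam * t) =
        Real.exp (-1) * Real.exp (p.1 - I + lam * t) := by
      rw [← Real.exp_add]; congr 1; ring
    have hE : 0 < B * Real.exp (p.1 - I + lam * t) := by positivity
    have h1 := (abs_le.1 (hB t ⟨ht.1.le, ht.2.le⟩ p)).2
    have h2 := hL (ρ + B * Real.exp (p.1 - I + lam * t)) ⟨by linarith, by linarith⟩ ρ
      ⟨by linarith, by linarith⟩
    rw [add_sub_cancel_left, abs_of_pos hE] at h2
    have h3 := (le_abs_self _).trans h2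
    have h4 := hg.neg ρ (Or.inl ⟨hρ, hρa⟩)
    simp only [discreteLaplacian, Int.cast_add, Int.cast_sub, Int.cast_one]
    rw [e1, e2]
    simp only [lam] at *
    linarith
  · simp only [neg_zero]
    positivity
  · simp only [mul_zero, add_zero]
    rcases le_total p.1 I with h | h
    · have h1 := hI p.1 h p.2
      have : 0 ≤ B * Real.exp (p.1 - I) := by positivity
      simp only [Prod.mk.eta] at h1
      linarith
    · have h1 := (abs_le.1 (hB 0 ⟨le_rfl, hT⟩ p)).2
      have h2 : 1 ≤ Real.exp ((p.1 : ℝ) - I) := by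
        rw [Real.one_le_exp_iff]
        exact sub_nonneg.2 (by exact_mod_cast h)
      nlinarith

/-- Small `z` is governed by `g' < 0` near `r`. For larger `z`, compactness keeps `g (r + z)` below
`-m`, and `η` is small enough that moving `r` to `x` costs at most half of `m`. Allowing `z₀` that
is not small is essential: the data are only known to lie below `a` on the left. -/
lemma exists_dissipation {g : ℝ → ℝ} (hg : ContDiff ℝ 1 g) {r z₀ : ℝ} (hr : g r = 0)
    (hd : deriv g r < 0) (hz₀ : 0 < z₀) (hneg : ∀ s ∈ Ioc r (r + z₀), g s < 0) :
    ∃ η > 0, ∃ β > 0, ∀ x ∈ Icc (r - η) (r + η), ∀ z ∈ Icc 0 z₀, g (x + z) ≤ g x - β * z := by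
  obtain ⟨b, hb, hb0⟩ := exists_between hd
  obtain ⟨δ, hδ, hball⟩ := Metric.eventually_nhds_iff_ball.1
    ((hg.continuous_deriv le_rfl).continuousAt.eventually_lt_const hb)
  obtain ⟨L, hL0, hL⟩ := exists_lipschitz_bound hg (|r| + z₀ + 1)
  set d := min (δ / 3) z₀
  have hd0 : 0 < d := lt_min (by positivity) hz₀
  have hdδ : d ≤ δ / 3 := min_le_left _ _
  obtain ⟨y, hy, hmax⟩ := (isCompact_Icc (a := r + d) (b := r + z₀)).exists_isMaxOn
    (nonempty_Icc.2 (by linarith [min_le_right (δ / 3) z₀])) hg.continuous.continuousOn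
  have hm : g y < 0 := hneg y ⟨by linarith [hy.1], hy.2⟩
  set m := -g y with hmdef
  have hm0 : 0 < m := by linarith
  set η := min (min d 1) (m / (4 * L + 4))
  have hηd : η ≤ d := (min_le_left _ _).trans (min_le_left _ _)
  have hη1 : η ≤ 1 := (min_le_left _ _).trans (min_le_right _ _)
  have hηm : η * (4 * L + 4) ≤ m := by
    rw [← le_div_iff₀ (by positivity)]
    exact min_le_right _ _
  have hη0 : 0 < η := lt_min (lt_min hd0 one_pos) (by positivity)
  refine ⟨η, hη0, min (-b) (m / (2 * z₀)), lt_min (by linarith) (by positivity),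
    fun x hx z hz => ?_⟩
  rcases le_total z d with h | h
  · have hsub := (convex_ball r δ).image_sub_le_mul_sub_of_deriv_le (f := g) (C := b)
      hg.continuous.continuousOn (hg.differentiable one_ne_zero).differentiableOn
      (fun s hs => (hball s (interior_subset hs)).le) x
      (by rw [Real.ball_eq_Ioo]; constructor <;> linarith [hx.1, hx.2]) (x + z)
      (by rw [Real.ball_eq_Ioo]; constructor <;> linarith [hx.1, hx.2, hz.1]) (by linarith [hz.1])
    have h2 := mul_le_mul_of_nonneg_right (min_le_left (-b) (m / (2 * z₀))) hz.1
    rw [add_sub_cancel_left] at hsub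
    linarith
  · have hr1 := neg_abs_le r
    have hr2 := le_abs_self r
    have hxr : |x - r| ≤ η := abs_le.2 ⟨by linarith [hx.1], by linarith [hx.2]⟩
    have h1 := hL (x + z) ⟨by linarith [hx.1, hz.1], by linarith [hx.2, hz.2]⟩ (r + z)
      ⟨by linarith [hz.1], by linarith [hz.2]⟩
    have h2 := hL x ⟨by linarith [hx.1], by linarith [hx.2]⟩ r ⟨by linarith, by linarith⟩
    rw [add_sub_add_right_eq_sub] at h1
    have h3 := mul_le_mul_of_nonneg_left hxr hL0
    have h4 : g (r + z) ≤ g y := hmax ⟨by linarith, by linarith [hz.2]⟩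
    have h5 : min (-b) (m / (2 * z₀)) * z ≤ m / 2 := by
      calc _ ≤ m / (2 * z₀) * z₀ :=
            mul_le_mul (min_le_right _ _) hz.2 hz.1 (by positivity)
        _ = m / 2 := by field_simp
    have h6 := (abs_le.1 h1).2
    have h7 := (abs_le.1 h2).1
    nlinarith

/-- The Fife-McLeod supersolution `Φ (i - c t + Z t) + z t`. -/
theorem IsSol.le_front_add {g Φ : ℝ → ℝ} {a c : ℝ} (hg : IsBistable g a)
    (hΦ : IsTravellingFront g Φ c) {u : ℝ → ℤ × ℤ → ℝ} (hu : IsSol g u) {T z₀ : ℝ} (hT : 0 ≤ T)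
    (hz₀ : 0 < z₀) (hz₀a : z₀ < a) (h1 : ∀ p, u T p ≤ 1 + z₀ / 2) {I : ℤ}
    (hI : ∀ i ≤ I, ∀ j, u T (i, j) ≤ z₀) :
    ∃ θ, ∃ β > 0, ∀ t, T ≤ t → ∀ p : ℤ × ℤ,
      u t p ≤ Φ (p.1 - c * t + θ) + z₀ * Real.exp (-β * (t - T)) := by
  have ha := hg.mem_Ioo
  obtain ⟨η₀, hη₀, β₀, hβ₀, hd₀⟩ := exists_dissipation hg.contDiff_one hg.zero_eq
    hg.deriv_zero_neg hz₀ fun s hs => hg.neg s (Or.inl ⟨hs.1, by linarith [hs.2]⟩)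
  obtain ⟨η₁, hη₁, β₁, hβ₁, hd₁⟩ := exists_dissipation hg.contDiff_one hg.one_eq
    hg.deriv_one_neg hz₀ fun s hs => hg.neg s (Or.inr hs.1)
  set β := min β₀ β₁
  have hβ : 0 < β := lt_min hβ₀ hβ₁
  obtain ⟨K₀, hK₀⟩ := eventually_atBot.1 (hΦ.tendsto_atBot.eventually_lt_const hη₀)
  obtain ⟨K₁, hK₁⟩ := eventually_atTop.1
    (hΦ.tendsto_atTop.eventually_const_lt (by linarith : 1 - η₁ < 1))
  obtain ⟨y, hy, hmin⟩ := (isCompact_Icc (a := min K₀ K₁) (b := max K₀ K₁)).exists_isMinOn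
    (nonempty_Icc.2 min_le_max) (hΦ.contDiff.continuous_deriv le_rfl).continuousOn
  have hκ := hΦ.deriv_pos hg y
  set κ := deriv Φ y
  obtain ⟨L, hL0, hL⟩ := exists_lipschitz_bound hg.contDiff_one 2
  -- In the transition zone, where `Φ' ≥ κ`, the drift `Z' = C z` must pay for the decay `β z` and
  -- the Lipschitz error `L z`. In the tails, dissipation suffices.
  set C := (β + L) / κ with hC
  have hC0 : 0 ≤ C := by positivity
  have hCκ : C * κ = β + L := by rw [hC]; field_simp
  have hΦI : ∀ x, Φ x ∈ Icc (0 : ℝ) 1 := hΦ.mem_Icc hg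
  obtain ⟨K, hK⟩ := eventually_atTop.1
    (hΦ.tendsto_atTop.eventually_const_lt (by linarith : 1 - z₀ / 2 < 1))
  -- At time `T` this puts `Φ` above `1 - z₀ / 2` for `i ≥ I`, so adding `z₀` dominates the bound `1
  -- + z₀ / 2`.
  set Z₀ := K - I + c * T
  set z : ℝ → ℝ := fun t => z₀ * Real.exp (-β * (t - T)) with hz
  set Z : ℝ → ℝ := fun t => Z₀ + C / β * (z₀ - z t) with hZ
  have hz0 : ∀ t, 0 ≤ z t := fun t => by positivity
  have hzz : ∀ t, T ≤ t → z t ≤ z₀ := by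
    intro t ht
    refine mul_le_of_le_one_right hz₀.le (Real.exp_le_one_iff.2 ?_)
    have := mul_nonneg hβ.le (sub_nonneg.2 ht)
    linarith
  have hz' : ∀ t, HasDerivAt z (-β * z t) t := by
    intro t
    have e : HasDerivAt (fun t => -β * (t - T)) (-β) t := by
      simpa using ((hasDerivAt_id t).sub_const T).const_mul (-β)
    refine (e.exp.const_mul z₀).congr_deriv ?_
    simp only [hz]; ring
  have hZ' : ∀ t, HasDerivAt Z (C * z t) t := by
    intro t
    refine ((((hz' t).const_sub z₀).const_mul (C / β)).const_add Z₀).congr_deriv ?_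
    field_simp
  have hw : ∀ t (p : ℤ × ℤ), HasDerivAt (fun t => Φ (p.1 - c * t + Z t) + z t)
      (deriv Φ (p.1 - c * t + Z t) * (-c + C * z t) + -β * z t) t := by
    intro t p
    have e : HasDerivAt (fun s => (p.1 : ℝ) - c * s) (-c) t := by
      simpa using ((hasDerivAt_id t).const_mul c).const_sub (p.1 : ℝ)
    exact ((hΦ.hasDerivAt _).comp t (e.add (hZ' t))).add (hz' t)
  refine ⟨Z₀ + C / β * z₀, β, hβ, fun t ht p => ?_⟩
  have key := hu.le_of_supersolution hg.contDiff_one (t₀ := T) (t₁ := t)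
    (w := fun t p => Φ (p.1 - c * t + Z t) + z t) hT
    (fun p => (continuous_iff_continuousAt.2 fun t => (hw t p).continuousAt).continuousOn)
    (fun t _ p => hw t p) (fun s hs p _ => ?_) ⟨0, fun s _ p => ?_⟩ (fun p => ?_) t
    ⟨ht, le_rfl⟩ p
  · refine key.trans (add_le_add_left (hΦ.monotone hg ?_) _)
    have : C / β * (z₀ - z t) ≤ C / β * z₀ :=
      mul_le_mul_of_nonneg_left (by linarith [hz0 t]) (by positivity)
    simp only [hZ]
    linarith
  · have hzs := hz0 s
    have hzs' := hzz s hs.1.le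
    have hwave := hΦ.wave_eq (p.1 - c * s + Z s)
    have e1 : (p.1 : ℝ) + 1 - c * s + Z s = p.1 - c * s + Z s + 1 := by ring
    have e2 : (p.1 : ℝ) - 1 - c * s + Z s = p.1 - c * s + Z s - 1 := by ring
    simp only [discreteLaplacian, Int.cast_add, Int.cast_sub, Int.cast_one, e1, e2]
    set ξ := (p.1 : ℝ) - c * s + Z s
    have hx := hΦI ξ
    suffices h : g (Φ ξ + z s) ≤ g (Φ ξ) + deriv Φ ξ * (C * z s) - β * z s by linarith
    have hΦ' := (hΦ.deriv_pos hg ξ).le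
    have hpos : 0 ≤ deriv Φ ξ * (C * z s) := by positivity
    have hβ₀z : β * z s ≤ β₀ * z s := mul_le_mul_of_nonneg_right (min_le_left _ _) hzs
    have hβ₁z : β * z s ≤ β₁ * z s := mul_le_mul_of_nonneg_right (min_le_right _ _) hzs
    by_cases hξ₀ : ξ ≤ K₀
    · have := hd₀ (Φ ξ) ⟨by linarith [hx.1], by linarith [hK₀ ξ hξ₀]⟩ (z s) ⟨hzs, hzs'⟩
      linarith
    by_cases hξ₁ : K₁ ≤ ξ
    · have := hd₁ (Φ ξ) ⟨by linarith [hK₁ ξ hξ₁], by linarith [hx.2]⟩ (z s) ⟨hzs, hzs'⟩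
      linarith
    · push Not at hξ₀ hξ₁
      have e3 : κ ≤ deriv Φ ξ :=
        hmin ⟨(min_le_left _ _).trans hξ₀.le, hξ₁.le.trans (le_max_right _ _)⟩
      have e4 : κ * (C * z s) ≤ deriv Φ ξ * (C * z s) :=
        mul_le_mul_of_nonneg_right e3 (by positivity)
      have e5 : κ * (C * z s) = (β + L) * z s := by rw [← hCκ]; ring
      have e6 := hL (Φ ξ + z s) ⟨by linarith [hx.1], by linarith [hx.2, ha.2]⟩ (Φ ξ)
        ⟨by linarith [hx.1], by linarith [hx.2]⟩
      rw [add_sub_cancel_left, abs_of_nonneg hzs] at e6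
      linarith [le_abs_self (g (Φ ξ + z s) - g (Φ ξ))]
  · rw [neg_zero]
    exact add_nonneg (hΦI _).1 (hz0 s)
  · have e1 : z T = z₀ := by simp [hz]
    simp only [e1]
    rcases le_total p.1 I with h | h
    · exact (hI p.1 h p.2).trans (le_add_of_nonneg_left (hΦI _).1)
    · have h2 := hK (p.1 - c * T + Z T) (by
        have : (I : ℝ) ≤ p.1 := by exact_mod_cast h
        simp only [hZ, e1, Z₀]
        linarith)
      linarith [h1 p]

theorem IsSol.exists_upper_bound {g Φ : ℝ → ℝ} {a c : ℝ} (hg : IsBistable g a)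
    (hΦ : IsTravellingFront g Φ c) {u : ℝ → ℤ × ℤ → ℝ} (hu : IsSol g u)
    (hleft : ∃ ρ < a, ∃ I : ℤ, ∀ i ≤ I, ∀ j, u 0 (i, j) ≤ ρ) :
    ∃ (T θ : ℝ) (ζ : ℝ → ℝ), 0 ≤ T ∧ Tendsto ζ atTop (𝓝 0) ∧
      ∀ t, T ≤ t → ∀ p : ℤ × ℤ, u t p ≤ Φ (p.1 - c * t + θ) + ζ t := by
  obtain ⟨ρ, hρ, I, hI⟩ := hleft
  obtain ⟨ρ', hρ', hρ'a⟩ := exists_between (max_lt hρ hg.mem_Ioo.1)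
  obtain ⟨z₀, hz₀, hz₀a⟩ := exists_between hρ'a
  have hρ0 : 0 < ρ' := (le_max_right _ _).trans_lt hρ'
  obtain ⟨T, hT, h1⟩ := hu.exists_le_one_add hg (half_pos (hρ0.trans hz₀))
  obtain ⟨I', hI'⟩ := hu.exists_le_left hg hρ0 hρ'a hz₀
    (fun i hi j => (hI i hi j).trans ((le_max_left _ _).trans hρ'.le)) hT
  obtain ⟨θ, β, hβ, h⟩ := hu.le_front_add hg hΦ hT (hρ0.trans hz₀) hz₀a h1 hI'
  refine ⟨T, θ, _, hT, ?_, h⟩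
  have h2 : Tendsto (fun t => -β * (t - T)) atTop atBot :=
    (tendsto_atTop_add_const_right _ (-T) tendsto_id).const_mul_atTop_of_neg (by linarith)
  simpa using (Real.tendsto_exp_atBot.comp h2).const_mul z₀

/-! ### Reflection, which turns upper bounds into lower bounds. -/

lemma hasDerivAt_reflect {g : ℝ → ℝ} (hg : Differentiable ℝ g) (s : ℝ) :
    HasDerivAt (fun s => -g (1 - s)) (deriv g (1 - s)) s :=
  ((hg (1 - s)).hasDerivAt.comp_const_sub 1 s).neg.congr_deriv (neg_neg _)

lemma IsBistable.reflect {g : ℝ → ℝ} {a : ℝ} (hg : IsBistable g a) :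
    IsBistable (fun s => -g (1 - s)) (1 - a) where
  contDiff := (hg.contDiff.comp (contDiff_const.sub contDiff_id)).neg
  mem_Ioo := ⟨by linarith [hg.mem_Ioo.2], by linarith [hg.mem_Ioo.1]⟩
  zero_eq := by simp [hg.one_eq]
  mid_eq := by simp [hg.mid_eq]
  one_eq := by simp [hg.zero_eq]
  deriv_zero_neg := by
    rw [(hasDerivAt_reflect (hg.contDiff_one.differentiable one_ne_zero) 0).deriv, sub_zero]
    exact hg.deriv_one_neg
  deriv_one_neg := by
    rw [(hasDerivAt_reflect (hg.contDiff_one.differentiable one_ne_zero) 1).deriv, sub_self]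
    exact hg.deriv_zero_neg
  pos s hs := by
    refine neg_pos.2 (hg.neg _ ?_)
    rcases hs with hs | hs
    · exact Or.inr (mem_Ioi.2 (by linarith [mem_Iio.1 hs]))
    · exact Or.inl ⟨by linarith [hs.2], by linarith [hs.1]⟩
  neg s hs := by
    refine neg_neg_iff_pos.2 (hg.pos _ ?_)
    rcases hs with hs | hs
    · exact Or.inr ⟨by linarith [hs.2], by linarith [hs.1]⟩
    · exact Or.inl (mem_Iio.2 (by linarith [mem_Ioi.1 hs]))

lemma IsTravellingFront.reflect {g Φ : ℝ → ℝ} {c : ℝ} (hΦ : IsTravellingFront g Φ c) :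
    IsTravellingFront (fun s => -g (1 - s)) (fun x => 1 - Φ (-x)) (-c) where
  speed_ne_zero := neg_ne_zero.2 hΦ.speed_ne_zero
  contDiff := contDiff_const.sub (hΦ.contDiff.comp contDiff_neg)
  tendsto_atBot := by
    simpa using (hΦ.tendsto_atTop.comp tendsto_neg_atBot_atTop).const_sub 1
  tendsto_atTop := by
    simpa using (hΦ.tendsto_atBot.comp tendsto_neg_atTop_atBot).const_sub 1
  wave_eq ξ := by
    have h1 : HasDerivAt (fun x => 1 - Φ (-x)) (deriv Φ (-ξ)) ξ := by
      simpa using ((hΦ.hasDerivAt (-ξ)).comp ξ (hasDerivAt_neg ξ)).const_sub 1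
    have h2 := hΦ.wave_eq (-ξ)
    rw [h1.deriv, sub_sub_cancel, show -(ξ + 1) = -ξ - 1 by ring, show -(ξ - 1) = -ξ + 1 by ring]
    linarith
  normalized := by simp [hΦ.normalized]; norm_num

lemma IsSol.reflect {g : ℝ → ℝ} {u : ℝ → ℤ × ℤ → ℝ} (hu : IsSol g u) :
    IsSol (fun s => -g (1 - s)) fun t p => 1 - u t (-p.1, p.2) where
  continuousOn p := continuousOn_const.sub (hu.continuousOn _)
  hasDerivAt t ht p := by
    refine ((hu.hasDerivAt t ht (-p.1, p.2)).const_sub 1).congr_deriv ?_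
    simp only [discreteLaplacian, sub_sub_cancel]
    rw [show -(p.1 + 1) = -p.1 - 1 by ring, show -(p.1 - 1) = -p.1 + 1 by ring]
    ring
  bdd T := by
    obtain ⟨B, hB⟩ := hu.bdd T
    refine ⟨1 + B, fun t ht p => (abs_sub _ _).trans ?_⟩
    simpa using hB t ht (-p.1, p.2)

/-- Front-like solutions are eventually trapped between two translates of the front, up to a
vanishing error. -/
theorem IsSol.exists_trap {g Φ : ℝ → ℝ} {a c : ℝ} (hg : IsBistable g a)
    (hΦ : IsTravellingFront g Φ c) {u : ℝ → ℤ × ℤ → ℝ} (hu : IsSol g u)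
    (hleft : ∃ ρ < a, ∃ I : ℤ, ∀ i ≤ I, ∀ j, u 0 (i, j) ≤ ρ)
    (hright : ∃ ρ > a, ∃ I : ℤ, ∀ i ≥ I, ∀ j, ρ ≤ u 0 (i, j)) :
    ∃ (T θ₁ θ₂ : ℝ) (ζ : ℝ → ℝ), 0 ≤ T ∧ Tendsto ζ atTop (𝓝 0) ∧
      ∀ t, T ≤ t → ∀ p : ℤ × ℤ, Φ (p.1 - c * t - θ₁) - ζ t ≤ u t p ∧
        u t p ≤ Φ (p.1 - c * t + θ₂) + ζ t := by
  obtain ⟨T₂, θ₂, ζ₂, hT₂, hζ₂, h₂⟩ := hu.exists_upper_bound hg hΦ hleft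
  obtain ⟨T₁, θ₁, ζ₁, hT₁, hζ₁, h₁⟩ := hu.reflect.exists_upper_bound hg.reflect hΦ.reflect (by
    obtain ⟨ρ, hρ, I, hI⟩ := hright
    exact ⟨1 - ρ, by linarith, -I, fun i hi j => by linarith [hI (-i) (by omega) j]⟩)
  refine ⟨max T₁ T₂, θ₁, θ₂, fun t => max (ζ₁ t) (ζ₂ t), hT₁.trans (le_max_left _ _),
    by simpa using hζ₁.max hζ₂, fun t ht p => ⟨?_, ?_⟩⟩
  · have h := h₁ t ((le_max_left _ _).trans ht) (-p.1, p.2)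
    simp only [neg_neg, Prod.mk.eta, Int.cast_neg] at h
    rw [show -(-(p.1 : ℝ) - -c * t + θ₁) = p.1 - c * t - θ₁ by ring] at h
    linarith [le_max_left (ζ₁ t) (ζ₂ t)]
  · have h := h₂ t ((le_max_right _ _).trans ht) p
    linarith [le_max_right (ζ₁ t) (ζ₂ t)]

/-! ### Convergence of each row to a translate of the front. -/

lemma exists_eventually_eq_of_mem_finite {ι α : Type*} {l : Ultrafilter ι} {f : ι → α}
    {s : Set α} (hs : s.Finite) (h : ∀ᶠ k in l, f k ∈ s) : ∃ x, ∀ᶠ k in l, f k = x := by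
  have h' : ∀ᶠ k in l, ∃ x ∈ s, f k = x := h.mono fun k hk => ⟨f k, hk, rfl⟩
  obtain ⟨x, -, hx⟩ := (Ultrafilter.eventually_exists_mem_iff hs).1 h'
  exact ⟨x, hx⟩

/-- A solution trapped between two translates of the front converges, along each horizontal line
and uniformly over the lines, to a translate of the front. -/
theorem IsSol.exists_front_approx {g Φ : ℝ → ℝ} {a c : ℝ} (hg : IsBistable g a)
    (hΦ : IsTravellingFront g Φ c) {u : ℝ → ℤ × ℤ → ℝ} (hu : IsSol g u) {T θ₁ θ₂ : ℝ}
    {ζ : ℝ → ℝ} (hT : 0 ≤ T) (hζ : Tendsto ζ atTop (𝓝 0))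
    (htrap : ∀ t, T ≤ t → ∀ p : ℤ × ℤ, Φ (p.1 - c * t - θ₁) - ζ t ≤ u t p ∧
        u t p ≤ Φ (p.1 - c * t + θ₂) + ζ t) {ε : ℝ} (hε : 0 < ε) :
    ∃ T', ∀ t, T' ≤ t → ∀ j : ℤ, ∃ γ : ℝ, ∀ i : ℤ, |u t (i, j) - Φ (i - γ)| ≤ ε := by
  by_contra! hcon
  have hΦI := hΦ.mem_Icc hg
  have hmono := hΦ.monotone hg
  obtain ⟨T₀, hT₀⟩ := eventually_atTop.1 (hζ.eventually_lt_const one_pos)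
  set T₁ := max T₀ T
  -- Bad times go to infinity, and `t k ≥ T₁ + k` makes the translate by `t k` a trapped solution,
  -- with error below `1`, on `(-k, ∞)`.
  choose t ht j hj using fun k : ℕ => hcon (T₁ + k)
  set m : ℕ → ℤ := fun k => ⌊c * t k⌋
  have hm : ∀ k, (m k : ℝ) ≤ c * t k := fun k => Int.floor_le _
  have hm' : ∀ k, c * t k < m k + 1 := fun k => Int.lt_floor_add_one _
  set W : ℕ → ℝ → ℤ × ℤ → ℝ := fun k s p => u (s + t k) (p + (m k, j k))
  have hpos : ∀ (k : ℕ) s, -(k : ℝ) < s → T₁ < s + t k := fun k s hs => by linarith [ht k]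
  have hlow : ∀ (k : ℕ) (s : ℝ) (p : ℤ × ℤ), -(k : ℝ) < s →
      Φ (p.1 - c * s - 1 - θ₁) - ζ (s + t k) ≤ W k s p := by
    intro k s p hs
    refine le_trans ?_ (htrap (s + t k) ((le_max_right _ _).trans (hpos k s hs).le)
      (p + (m k, j k))).1
    refine sub_le_sub_right (hmono ?_) _
    push_cast [Prod.fst_add]
    linarith [hm' k]
  have hupp : ∀ (k : ℕ) (s : ℝ) (p : ℤ × ℤ), -(k : ℝ) < s →
      W k s p ≤ Φ (p.1 - c * s + θ₂) + ζ (s + t k) := by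
    intro k s p hs
    refine (htrap (s + t k) ((le_max_right _ _).trans (hpos k s hs).le)
      (p + (m k, j k))).2.trans ?_
    refine add_le_add_left (hmono ?_) _
    push_cast [Prod.fst_add]
    linarith [hm k]
  obtain ⟨w, hwt, hwd⟩ := exists_ultralimit hg.contDiff_one W 2 (fun k s p hs => by
      have h1 := hT₀ (s + t k) ((le_max_left _ _).trans (hpos k s hs).le)
      rw [abs_le]
      constructor
      · linarith [hlow k s p hs, (hΦI (p.1 - c * s - 1 - θ₁)).1]
      · linarith [hupp k s p hs, (hΦI (p.1 - c * s + θ₂)).2]) (fun k s p hs => by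
      rw [laplacian_shift]
      exact (hu.hasDerivAt (s + t k) ((hT.trans (le_max_right _ _)).trans_lt (hpos k s hs))
        (p + (m k, j k))).comp_add_const s (t k))
  have htt : Tendsto t (hyperfilter ℕ) atTop := by
    refine (tendsto_atTop_mono ht ?_).mono_left Nat.hyperfilter_le_atTop
    exact tendsto_atTop_add_const_left _ _ tendsto_natCast_atTop_atTop
  have hζt : ∀ s, Tendsto (fun k => ζ (s + t k)) (hyperfilter ℕ) (𝓝 0) := fun s =>
    hζ.comp (tendsto_atTop_add_const_left _ s htt)
  have hwlow : ∀ (s : ℝ) (p : ℤ × ℤ), Φ (p.1 - c * s - 1 - θ₁) ≤ w s p := by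
    intro s p
    have h1 := (hζt s).const_sub (Φ (p.1 - c * s - 1 - θ₁))
    rw [sub_zero] at h1
    exact le_of_tendsto_of_tendsto h1 (hwt s p)
      ((eventually_neg_lt_hyperfilter s).mono fun k hk => hlow k s p hk)
  have hwupp : ∀ (s : ℝ) (p : ℤ × ℤ), w s p ≤ Φ (p.1 - c * s + θ₂) := by
    intro s p
    have h1 := (hζt s).const_add (Φ (p.1 - c * s + θ₂))
    rw [add_zero] at h1
    exact le_of_tendsto_of_tendsto (hwt s p) h1
      ((eventually_neg_lt_hyperfilter s).mono fun k hk => hupp k s p hk)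
  have hw : IsEntire g w :=
    ⟨fun s p => ⟨(hΦI _).1.trans (hwlow s p), (hwupp s p).trans (hΦI _).2⟩, hwd⟩
  have tw : HasTails c w := by
    refine ⟨fun e he => ?_, fun e he => ?_⟩
    · obtain ⟨R, hR⟩ := eventually_atBot.1 (hΦ.tendsto_atBot.eventually_lt_const he)
      exact ⟨R - θ₂, fun s p h => (hwupp s p).trans (hR _ (by linarith)).le⟩
    · obtain ⟨R, hR⟩ := eventually_atTop.1
        (hΦ.tendsto_atTop.eventually_const_lt (by linarith : 1 - e < 1))
      exact ⟨R + 1 + θ₁, fun s p h => (hR _ (by linarith)).le.trans (hwlow s p)⟩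
  obtain ⟨θ, hθ⟩ := hΦ.eq_of_isEntire hg hw tw
  -- The limit selects the phase `m k - θ`; by assumption it fails at some column `i k`.
  choose i hi using fun k => hj k (m k - θ)
  have hW : ∀ k, ε < |W k 0 (i k - m k, 0) - Φ ((i k - m k : ℤ) + θ)| := by
    intro k
    have := hi k
    rw [sub_sub_eq_add_sub, add_sub_right_comm] at this
    simpa [W] using this
  obtain ⟨R₀, hR₀⟩ := eventually_atBot.1
    (hΦ.tendsto_atBot.eventually_lt_const (by positivity : 0 < ε / 4))
  obtain ⟨R₁, hR₁⟩ := eventually_atTop.1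
    (hΦ.tendsto_atTop.eventually_const_lt (by linarith : 1 - ε / 4 < 1))
  -- In the far tails the trap already gives an error below `ε`. The bad columns thus stay in a
  -- finite window, where the ultrafilter fixes one offset and pointwise convergence contradicts the
  -- error.
  have hfin : ∀ᶠ k in hyperfilter ℕ, i k - m k ∈
      Icc ⌊min (R₀ - θ₂) (R₀ - θ)⌋ ⌈max (R₁ + 1 + θ₁) (R₁ - θ)⌉ := by
    filter_upwards [(hζt 0).eventually_lt_const (by positivity : 0 < ε / 4),
      eventually_neg_lt_hyperfilter 0] with k hk hk0
    have h1 := hlow k 0 (i k - m k, 0) hk0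
    have h2 := hupp k 0 (i k - m k, 0) hk0
    simp only [mul_zero, sub_zero] at h1 h2
    have h3 := hW k
    set d := i k - m k
    constructor
    · by_contra! hd
      have hd' : (d : ℝ) ≤ min (R₀ - θ₂) (R₀ - θ) := Int.le_floor.1 hd.le
      have e1 := hR₀ (d + θ₂) (by linarith [min_le_left (R₀ - θ₂) (R₀ - θ)])
      have e2 := hR₀ (d + θ) (by linarith [min_le_right (R₀ - θ₂) (R₀ - θ)])
      refine h3.not_ge (abs_le.2 ⟨?_, ?_⟩)
      · linarith [(hΦI (d - 1 - θ₁)).1]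
      · linarith [(hΦI (d + θ)).1]
    · by_contra! hd
      have hd' : max (R₁ + 1 + θ₁) (R₁ - θ) ≤ d := Int.ceil_le.1 hd.le
      have e1 := hR₁ (d - 1 - θ₁) (by linarith [le_max_left (R₁ + 1 + θ₁) (R₁ - θ)])
      have e2 := hR₁ (d + θ) (by linarith [le_max_right (R₁ + 1 + θ₁) (R₁ - θ)])
      refine h3.not_ge (abs_le.2 ⟨?_, ?_⟩)
      · linarith [(hΦI (d + θ)).2]
      · linarith [(hΦI (d + θ₂)).2]
  obtain ⟨d, hd⟩ := exists_eventually_eq_of_mem_finite (finite_Icc _ _) hfin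
  have hlim := ((hwt 0 (d, 0)).sub_const (Φ (d + θ))).abs
  rw [hθ 0 (d, 0)] at hlim
  simp only [mul_zero, sub_zero, sub_self, abs_zero] at hlim
  obtain ⟨k, hk, hk'⟩ := (hd.and (hlim.eventually_lt_const hε)).exists
  have := hW k
  rw [hk] at this
  linarith

/-! ### Crossings and phases of sequences close to the front. -/

namespace IsTravellingFront

variable {g Φ : ℝ → ℝ} {a c : ℝ}

lemma exists_increment_bound (hg : IsBistable g a) (hΦ : IsTravellingFront g Φ c) {δ : ℝ}
    (hδ : 0 < δ) (A B : ℝ) : ∃ m > 0, ∀ x ∈ Icc A B, m ≤ Φ (x + δ) - Φ x := by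
  have hc := hΦ.contDiff.continuous
  rcases (Icc A B).eq_empty_or_nonempty with h | h
  · exact ⟨1, one_pos, by simp [h]⟩
  obtain ⟨y, -, hmin⟩ := isCompact_Icc.exists_isMinOn h
    (f := fun x => Φ (x + δ) - Φ x) (by fun_prop)
  exact ⟨Φ (y + δ) - Φ y, sub_pos.2 (hΦ.strictMono hg (by linarith)), fun x hx => hmin hx⟩

lemma exists_lipschitz (hg : IsBistable g a) (hΦ : IsTravellingFront g Φ c) :
    ∃ C, 0 ≤ C ∧ ∀ x y, |Φ x - Φ y| ≤ C * |x - y| := by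
  obtain ⟨C, hC, h⟩ := exists_time_lipschitz_bound hg.contDiff_one 1
  have hc := hΦ.speed_ne_zero
  refine ⟨C * |(-c)⁻¹|, by positivity, fun x y => ?_⟩
  have he := hΦ.isEntire hg
  set τ := min (-x / c) (-y / c) - 1
  have := h _ τ (fun t p _ => he.abs_le_one t p) (fun t p _ => he.hasDerivAt t p)
    (-x / c) (-y / c) 0 (by linarith [min_le_left (-x / c) (-y / c)])
    (by linarith [min_le_right (-x / c) (-y / c)])
  have e : ∀ x : ℝ, ((0 : ℤ × ℤ).1 : ℝ) - c * (-x / c) = x := by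
    intro x
    simp only [Prod.fst_zero, Int.cast_zero]
    field_simp
    ring
  simp only [e] at this
  rw [mul_assoc, ← abs_mul]
  rwa [show -x / c - -y / c = (-c)⁻¹ * (x - y) by field_simp; ring] at this

lemma existsUnique_eq (hg : IsBistable g a) (hΦ : IsTravellingFront g Φ c) {y : ℝ} (hy : 0 < y)
    (hy' : y ≤ 1 / 2) : ∃! ξ, Φ ξ = y := by
  obtain ⟨x, hx⟩ := (hΦ.tendsto_atBot.eventually_lt_const hy).exists
  obtain ⟨ξ, hξ⟩ := mem_range_of_exists_le_of_exists_ge hΦ.contDiff.continuous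
    ⟨x, hx.le⟩ ⟨0, hy'.trans hΦ.normalized.ge⟩
  exact ⟨ξ, hξ, fun z hz => (hΦ.strictMono hg).injective (hz.trans hξ.symm)⟩

/-- A sequence close to a translate of the front crosses the level `1 / 2` exactly once, and the
interpolated phase is close to that of the translate. -/
lemma existsUnique_crossing (hg : IsBistable g a) (hΦ : IsTravellingFront g Φ c) {δ : ℝ}
    (hδ : 0 < δ) : ∃ ε > 0, ∃ K, ∀ (v : ℤ → ℝ) (γ : ℝ), (∀ i : ℤ, |v i - Φ (i - γ)| ≤ ε) →
      (∃! i : ℤ, (0 < v i ∧ v i ≤ 1 / 2) ∧ 1 / 2 < v (i + 1)) ∧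
      ∀ i : ℤ, v i ≤ 1 / 2 → 1 / 2 < v (i + 1) → ∀ ξ, Φ ξ = v i →
        |i - ξ - γ| ≤ δ ∧ |ξ| ≤ K := by
  have hsm := hΦ.strictMono hg
  obtain ⟨K₀, hK₀⟩ := eventually_atBot.1
    (hΦ.tendsto_atBot.eventually_lt_const (by norm_num : (0 : ℝ) < 1 / 4))
  obtain ⟨K₁, hK₁⟩ := eventually_atTop.1
    (hΦ.tendsto_atTop.eventually_const_lt (by norm_num : (3 / 4 : ℝ) < 1))
  obtain ⟨m, hm, hmb⟩ := hΦ.exists_increment_bound hg hδ (K₀ - 1 - δ) K₁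
  obtain ⟨n, hn, hnb⟩ := hΦ.exists_increment_bound hg one_pos (K₀ - 1) K₁
  have hΦ0 : 0 < Φ (K₀ - 1) := (hΦ.mem_Icc hg (K₀ - 1 - 1)).1.trans_lt (hsm (by linarith))
  -- Respectively: `1 / 8` locates the crossing between `K₀ - 1` and `K₁`, `m / 2` controls the
  -- phase to within `δ`, `n / 3` keeps the sequence above `1 / 2` beyond the crossing, and the last
  -- term makes the crossing value positive.
  set ε := min (min (1 / 8) (m / 2)) (min (n / 3) (Φ (K₀ - 1) / 2))
  have hε8 : ε ≤ 1 / 8 := (min_le_left _ _).trans (min_le_left _ _)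
  have hεm : ε ≤ m / 2 := (min_le_left _ _).trans (min_le_right _ _)
  have hεn : ε ≤ n / 3 := (min_le_right _ _).trans (min_le_left _ _)
  have hεΦ : ε ≤ Φ (K₀ - 1) / 2 := (min_le_right _ _).trans (min_le_right _ _)
  have hε : 0 < ε := by positivity
  refine ⟨ε, hε, |K₀ - 1 - δ|, fun v γ hv => ?_⟩
  have hvl : ∀ i : ℤ, Φ (i - γ) ≤ v i + ε := fun i => by linarith [(abs_le.1 (hv i)).1]
  have hvu : ∀ i : ℤ, v i ≤ Φ (i - γ) + ε := fun i => by linarith [(abs_le.1 (hv i)).2]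
  have hlt : ∀ i : ℤ, v i ≤ 1 / 2 → i - γ < K₁ := by
    intro i hi
    by_contra! h
    linarith [hK₁ _ h, hvl i]
  have hgt : ∀ i : ℤ, 1 / 2 < v i → K₀ < i - γ := by
    intro i hi
    by_contra! h
    linarith [hK₀ _ h, hvu i]
  have hgt' : ∀ i : ℤ, 1 / 2 < v (i + 1) → K₀ - 1 < i - γ := by
    intro i hi
    have := hgt _ hi
    push_cast at this
    linarith
  constructor
  · obtain ⟨i, hi, hmax⟩ := Int.exists_greatest_of_bdd (P := fun i => v i ≤ 1 / 2)
      ⟨⌈K₁ + γ⌉, fun i hi => by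
        have := hlt i hi
        exact_mod_cast (by linarith [Int.le_ceil (K₁ + γ)] : (i : ℝ) ≤ ⌈K₁ + γ⌉)⟩
      ⟨⌊K₀ + γ⌋, by
        by_contra! h
        have := hgt _ h
        linarith [Int.floor_le (K₀ + γ)]⟩
    have hi1 : 1 / 2 < v (i + 1) := by
      by_contra! h
      have := hmax (i + 1) h
      omega
    have huniq : ∀ i i' : ℤ, 1 / 2 < v (i + 1) → v i' ≤ 1 / 2 → i' ≤ i := by
      intro i i' h1 h2
      by_contra! hlt'
      rcases (Int.add_one_le_iff.2 hlt').eq_or_lt with h | h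
      · rw [← h] at h2
        linarith
      · have e1 : ((i + 1 : ℤ) : ℝ) - γ + 1 ≤ i' - γ := by
          have : ((i + 1 + 1 : ℤ) : ℝ) ≤ i' := by exact_mod_cast h
          push_cast at this ⊢
          linarith
        have e2 := hsm.monotone e1
        have e3 := hnb (((i + 1 : ℤ) : ℝ) - γ)
          ⟨by linarith [hgt _ h1], by linarith [hlt i' h2]⟩
        linarith [hvl i', hvu (i + 1)]
    refine ⟨i, ⟨⟨?_, hi⟩, hi1⟩, fun i' hi' => le_antisymm (huniq i i' hi1 hi'.1.2)
      (huniq i' i hi'.2 hi)⟩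
    have := hsm.monotone (hgt' i hi1).le
    linarith [hvl i]
  · intro i hi hi1 ξ hξ
    have h1 := hgt' i hi1
    have h2 := hlt i hi
    have h3 : |(i : ℝ) - ξ - γ| ≤ δ := by
      rw [abs_le]
      constructor
      · by_contra! h
        have e1 := hsm.monotone (by linarith : (i : ℝ) - γ + δ ≤ ξ)
        have e2 := hmb (i - γ) ⟨by linarith, h2.le⟩
        linarith [hvu i]
      · by_contra! h
        have e1 := hsm.monotone (by linarith : ξ ≤ (i : ℝ) - γ - δ)
        have e2 := hmb (i - γ - δ) ⟨by linarith, by linarith⟩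
        rw [sub_add_cancel] at e2
        linarith [hvl i]
    refine ⟨h3, ?_⟩
    have h4 : ξ ≤ 0 := by
      rw [← hsm.le_iff_le, hξ, hΦ.normalized]
      exact hi
    rw [abs_of_nonpos h4]
    refine le_trans ?_ (neg_le_abs _)
    linarith [(abs_le.1 h3).2]

end IsTravellingFront

/-! ### From the Banach-space formulation to the conclusion. -/

lemma IsSolution.isSol {g : ℝ → ℝ} {u₀ : EllInf} {u : ℝ → EllInf} (hu : IsSolution g u₀ u) :
    IsSol g fun t p => u t p where
  continuousOn p := by
    have h : ∀ x y : EllInf, dist (x p) (y p) ≤ 1 * dist x y := fun x y => by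
      rw [one_mul, dist_eq_norm, dist_eq_norm]
      exact lp.norm_apply_le_norm ENNReal.top_ne_zero (x - y) p
    exact (LipschitzWith.of_dist_le_mul (K := 1) h).continuous.comp_continuousOn
      hu.contDiffOn.continuousOn
  hasDerivAt t ht p := hu.hasDerivAt t ht p.1 p.2
  bdd T := by
    obtain ⟨B, hB⟩ := (isCompact_Icc (a := 0) (b := T)).exists_bound_of_continuousOn
      (hu.contDiffOn.continuousOn.mono Icc_subset_Ici_self)
    exact ⟨B, fun t ht p => (lp.norm_apply_le_norm ENNReal.top_ne_zero (u t) p).trans (hB t ht)⟩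

lemma IsFrontLike.exists_left {u₀ : EllInf} {a : ℝ} (h : IsFrontLike u₀ a) :
    ∃ ρ < a, ∃ I : ℤ, ∀ i ≤ I, ∀ j, u₀ (i, j) ≤ ρ := by
  have hb : ∀ p, |u₀ p| ≤ ‖u₀‖ := lp.norm_apply_le_norm ENNReal.top_ne_zero u₀
  obtain ⟨ρ, hρ, hρa⟩ := exists_between h.left
  have hbdd : IsBoundedUnder (· ≤ ·) atBot fun i : ℤ => ⨆ j : ℤ, u₀ (i, j) :=
    isBoundedUnder_of ⟨‖u₀‖, fun i => ciSup_le fun j => (abs_le.1 (hb _)).2⟩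
  obtain ⟨I, hI⟩ := eventually_atBot.1 (eventually_lt_of_limsup_lt hρ hbdd)
  refine ⟨ρ, hρa, I, fun i hi j => ?_⟩
  have hbd : BddAbove (range fun j : ℤ => u₀ (i, j)) :=
    ⟨‖u₀‖, by rintro _ ⟨j, rfl⟩; exact (abs_le.1 (hb _)).2⟩
  exact (le_ciSup hbd j).trans (hI i hi).le

lemma IsFrontLike.exists_right {u₀ : EllInf} {a : ℝ} (h : IsFrontLike u₀ a) :
    ∃ ρ > a, ∃ I : ℤ, ∀ i ≥ I, ∀ j, ρ ≤ u₀ (i, j) := by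
  have hb : ∀ p, |u₀ p| ≤ ‖u₀‖ := lp.norm_apply_le_norm ENNReal.top_ne_zero u₀
  obtain ⟨ρ, hρa, hρ⟩ := exists_between h.right
  have hbdd : IsBoundedUnder (· ≥ ·) atTop fun i : ℤ => ⨅ j : ℤ, u₀ (i, j) :=
    isBoundedUnder_of ⟨-‖u₀‖, fun i => le_ciInf fun j => (abs_le.1 (hb _)).1⟩
  obtain ⟨I, hI⟩ := eventually_atTop.1 (eventually_lt_of_lt_liminf hρ hbdd)
  refine ⟨ρ, hρa, I, fun i hi j => ?_⟩
  have hbd : BddBelow (range fun j : ℤ => u₀ (i, j)) :=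
    ⟨-‖u₀‖, by rintro _ ⟨j, rfl⟩; exact (abs_le.1 (hb _)).1⟩
  exact (hI i hi).le.trans (ciInf_le hbd j)

lemma isCrossing_crossingIndex {v : EllInf} {j i : ℤ} (h : IsCrossing v j i) :
    IsCrossing v j (crossingIndex v j) :=
  Classical.epsilon_spec (p := fun i => IsCrossing v j i) ⟨i, h⟩

end AllenCahn

open AllenCahn in
theorem theorem2p2 (g Φ : ℝ → ℝ) (a c : ℝ) (u₀ : AllenCahn.EllInf) (u : ℝ → AllenCahn.EllInf)
    (hg : AllenCahn.IsBistable g a) (hΦ : AllenCahn.IsTravellingFront g Φ c)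
    (h₀ : AllenCahn.IsFrontLike u₀ a) (hu : AllenCahn.IsSolution g u₀ u) :
    (∃ T : ℝ, 0 < T ∧ ∀ t : ℝ, T ≤ t →
      (∀ j : ℤ, ∃! i : ℤ, AllenCahn.IsCrossing (u t) j i) ∧
      (∀ j i : ℤ, AllenCahn.IsCrossing (u t) j i → ∃! ξ : ℝ, Φ ξ = u t (i, j)) ∧
      Memℓp (fun j : ℤ => AllenCahn.phase Φ (u t) j) ∞) ∧
    Tendsto
      (fun t : ℝ => ⨆ p : ℤ × ℤ,
        ENNReal.ofReal |u t p - Φ ((p.1 : ℝ) - AllenCahn.phase Φ (u t) p.2)|)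
      atTop (𝓝 0) := by
  have hsol := hu.isSol
  have hsm := hΦ.strictMono hg
  obtain ⟨T, θ₁, θ₂, ζ, hT, hζ, htrap⟩ := hsol.exists_trap hg hΦ
    (by simpa only [hu.initial] using h₀.exists_left)
    (by simpa only [hu.initial] using h₀.exists_right)
  have happrox := fun ε (hε : 0 < ε) => hsol.exists_front_approx hg hΦ hT hζ htrap hε
  have hinv : ∀ (v : EllInf) (j : ℤ), IsCrossing v j (crossingIndex v j) →
      Φ (Function.invFun Φ (v (crossingIndex v j, j))) = v (crossingIndex v j, j) :=
    fun v j h => Function.invFun_eq (hΦ.existsUnique_eq hg h.1.1 h.1.2).exists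
  constructor
  · obtain ⟨ε, hε, K, hK⟩ := hΦ.existsUnique_crossing hg one_pos
    obtain ⟨T₁, hT₁⟩ := happrox ε hε
    obtain ⟨T₂, hT₂⟩ := eventually_atTop.1
      (hζ.eventually_lt_const (by norm_num : (0 : ℝ) < 1 / 8))
    refine ⟨max (max T₁ T₂) (max T 1), by positivity, fun t ht => ?_⟩
    have ht1 : T₁ ≤ t := (le_max_left _ _).trans ((le_max_left _ _).trans ht)
    have ht2 : T₂ ≤ t := (le_max_right _ _).trans ((le_max_left _ _).trans ht)
    have ht3 : T ≤ t := (le_max_left _ _).trans ((le_max_right _ _).trans ht)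
    have hcross : ∀ j, ∃! i, IsCrossing (u t) j i := fun j => by
      obtain ⟨γ, hγ⟩ := hT₁ t ht1 j
      exact (hK (fun i => u t (i, j)) γ hγ).1
    refine ⟨hcross, fun j i h => hΦ.existsUnique_eq hg h.1.1 h.1.2, ?_⟩
    obtain ⟨K₀, hK₀⟩ := eventually_atBot.1
      (hΦ.tendsto_atBot.eventually_lt_const (by norm_num : (0 : ℝ) < 1 / 4))
    obtain ⟨K₁, hK₁⟩ := eventually_atTop.1
      (hΦ.tendsto_atTop.eventually_const_lt (by norm_num : (3 / 4 : ℝ) < 1))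
    rw [memℓp_infty_iff]
    -- The trap bounds the crossing index by the first two terms, independently of the row; `K`
    -- bounds the inverse image under `Φ`.
    refine ⟨|K₀ - 1 + c * t - θ₂| + |K₁ + c * t + θ₁| + K, ?_⟩
    rintro _ ⟨j, rfl⟩
    obtain ⟨i, hi, -⟩ := hcross j
    have hc := isCrossing_crossingIndex hi
    obtain ⟨γ, hγ⟩ := hT₁ t ht1 j
    have hξ := ((hK (fun i => u t (i, j)) γ hγ).2 _ hc.1.2 hc.2 _ (hinv _ _ hc)).2
    simp only [phase]
    set k := crossingIndex (u t) j
    refine (norm_sub_le _ _).trans (add_le_add ?_ hξ)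
    have h1 : (k : ℝ) ≤ K₁ + c * t + θ₁ := by
      by_contra! h
      have e1 := hK₁ (k - c * t - θ₁) (by linarith)
      have e2 := (htrap t ht3 (k, j)).1
      linarith [hT₂ t ht2, hc.1.2]
    have h2 : K₀ - 1 + c * t - θ₂ ≤ k := by
      by_contra! h
      have e1 := hK₀ ((k + 1 : ℤ) - c * t + θ₂) (by push_cast; linarith)
      have e2 := (htrap t ht3 (k + 1, j)).2
      linarith [hT₂ t ht2, hc.2]
    rw [Real.norm_eq_abs, abs_le]
    constructor
    · linarith [neg_abs_le (K₀ - 1 + c * t - θ₂), abs_nonneg (K₁ + c * t + θ₁)]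
    · linarith [le_abs_self (K₁ + c * t + θ₁), abs_nonneg (K₀ - 1 + c * t - θ₂)]
  · rw [ENNReal.tendsto_nhds_zero]
    intro e he
    obtain ⟨r, hr0, hre⟩ := ENNReal.lt_iff_exists_nnreal_btwn.1 he
    have hr : (0 : ℝ) < r := by exact_mod_cast hr0
    obtain ⟨C, hC, hLip⟩ := hΦ.exists_lipschitz hg
    -- The tolerance is split in halves: closeness of the row to its translate, and `C` times the
    -- phase error. Using `C + 1` avoids division by zero.
    obtain ⟨ε, hε, K, hK⟩ := hΦ.existsUnique_crossing hg
      (δ := r / (2 * (C + 1))) (by positivity)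
    obtain ⟨T₁, hT₁⟩ := happrox (min ε (r / 2)) (by positivity)
    filter_upwards [eventually_ge_atTop T₁] with t ht
    refine iSup_le fun ⟨i, j⟩ => le_trans ?_ hre.le
    rw [← ENNReal.ofReal_coe_nnreal]
    refine ENNReal.ofReal_le_ofReal ?_
    obtain ⟨γ, hγ⟩ := hT₁ t ht j
    have hγ' := hK (fun i => u t (i, j)) γ fun i => (hγ i).trans (min_le_left _ _)
    obtain ⟨k, hk, -⟩ := hγ'.1
    have hc := isCrossing_crossingIndex (v := u t) (j := j) (i := k) hk
    have hph : |phase Φ (u t) j - γ| ≤ r / (2 * (C + 1)) :=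
      (hγ'.2 _ hc.1.2 hc.2 _ (hinv _ _ hc)).1
    have h1 := (hγ i).trans (min_le_right _ _)
    have h2 := hLip (i - γ) (i - phase Φ (u t) j)
    rw [sub_sub_sub_cancel_left] at h2
    have h3 : C * |phase Φ (u t) j - γ| ≤ r / 2 := by
      calc _ ≤ (C + 1) * (r / (2 * (C + 1))) := by gcongr; linarith
        _ = r / 2 := by field_simp
    have h4 := abs_sub_le (u t (i, j)) (Φ (i - γ)) (Φ (i - phase Φ (u t) j))
    simp only
    linarith
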